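/- Let $\Lambda$ be a locally compact Polish space with its Borel $\sigma$-algebra and let $\mu$ be a $\sigma$-finite Borel measure on $\Lambda$. A *simple point process* on $\Lambda$ is a random Radon measure $\chi$ on $\Lambda$ with values in $\{0,1,2,\dots,\infty\}$ such that almost surely $\chi(\{x\})\le 1$ for every $x\in\Lambda$. It is *determinantal* on $(\Lambda,\mu)$ with kernel $K:\Lambda^2\to\mathbb C$ if for every $k\ge 1$ it has a joint intensity $\rho_k:\Lambda^k\to[0,\infty)$, that is, a ($\mu^{\otimes k}$-a.e.) measurable function with $$\mathbb E\Bigl[\prod_{i=1}^k\chi(A_i)\Bigr]=\int_{A_1}\!\cdots\int_{A_k}\rho_k(x_1,\dots,x_k)\,d\mu(x_1)\cdots d\mu(x_k)$$ for all pairwise disjoint Borel sets $A_1,\dots,A_k\subseteq\Lambda$, and $$\rho_k(x_1,\dots,x_k)=\det\bigl[K(x_i,x_j)\bigr]_{i,j=1}^k\qquad\text{for }\mu^{\otimes k}\text{-a.e. }(x_1,\dots,x_k).$$ For integer-valued random variables $X,Y$, possibly defined on different probability spaces, put $$d_{TV}(X,Y)=\sup_{A\subseteq\mathbb Z}\bigl|\mathbb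 P[X\in A]-\mathbb P[Y\in A]\bigr|,\qquad W_1(X,Y)=\inf_{(Z_1,Z_2)}\mathbb E|Z_1-Z_2|,$$ where the infimum is over all random vectors $(Z_1,Z_2)$ such that $Z_1$ has the distribution of $X$ and $Z_2$ has the distribution of $Y$. **Proposition.** Let $\chi$ and $\widetilde\chi$ be determinantal point processes on $(\Lambda,\mu)$, possibly defined on different probability spaces, with kernels $K$ and $\widetilde K$ respectively. Suppose that $K(x,y)=\overline{K(y,x)}$ and $\widetilde K(x,y)=\overline{\widetilde K(y,x)}$ for all $x,y\in\Lambda$, and that $K,\widetilde K\in L^2(\mu\otimes\mu)$. Let $\mathcal N=\chi(\Lambda)$ and $\widetilde{\mathcal N}=\widetilde\chi(\Lambda)$ be the total numbers of points, and let $N\ge 0$ be an integer with $\mathcal N\le N$ and $\widetilde{\mathcal N}\le N$ almost surely. Then $$d_{TV}(\mathcal N,\widetilde{\mathcal N})\le W_1(\mathcal N,\widetilde{\mathcal N})\le\sqrt{N\int_\Lambda\int_\Lambda\bigl|K(x,y)-\widetilde K(x,y)\bigr|^2\,d\mu(x)\,d\mu(y)}.$$ -/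

import Mathlib

open MeasureTheory
open scoped ENNReal NNReal

/-- `χ`, defined on the probability space `(Ω, P)`, is a simple point process on `Λ`: a random
locally finite (Radon) measure which takes values in `{0, 1, 2, …, ∞}` and gives mass at most `1`
to every singleton. Measurability of `χ` means that `ω ↦ χ ω A` is measurable for every
measurable `A`. -/
structure IsSimplePointProcess {Ω Λ : Type*} [MeasurableSpace Ω] [TopologicalSpace Λ]
    [MeasurableSpace Λ] (P : Measure Ω) (χ : Ω → Measure Λ) : Prop where
  measurable : Measurable χ
  locallyFinite : ∀ᵐ ω ∂P, IsLocallyFiniteMeasure (χ ω)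
  integerValued : ∀ᵐ ω ∂P, ∀ A : Set Λ, MeasurableSet A → ∃ n : ℕ∞, χ ω A = (n : ℝ≥0∞)
  simple : ∀ᵐ ω ∂P, ∀ x : Λ, χ ω {x} ≤ 1

/-- `ρ : Λᵏ → [0, ∞)` is a `k`-th joint intensity of `χ` with respect to `μ`:
`E[∏ χ(Aᵢ)] = ∫_{A₁ × ⋯ × A_k} ρ dμᵏ` for all pairwise disjoint measurable `A₁, …, A_k`. -/
structure IsJointIntensity {Ω Λ : Type*} [MeasurableSpace Ω] [MeasurableSpace Λ]
    (P : Measure Ω) (χ : Ω → Measure Λ) (μ : Measure Λ) (k : ℕ) (ρ : (Fin k → Λ) → ℝ≥0) :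
    Prop where
  aemeasurable : AEMeasurable ρ (Measure.pi fun _ => μ)
  lintegral_prod_eq : ∀ A : Fin k → Set Λ, (∀ i, MeasurableSet (A i)) →
    Pairwise (fun i j => Disjoint (A i) (A j)) →
    ∫⁻ ω, ∏ i, χ ω (A i) ∂P =
      ∫⁻ x in Set.univ.pi A, (ρ x : ℝ≥0∞) ∂(Measure.pi fun _ => μ)

/-- `χ` is a determinantal point process on `(Λ, μ)` with kernel `K`: a simple point process whose
joint intensities of all orders exist and are given by `ρ_k(x) = det [K(xᵢ, xⱼ)]`
(as functions on `Λᵏ`, up to `μᵏ`-null sets). -/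
structure IsDeterminantal {Ω Λ : Type*} [MeasurableSpace Ω] [TopologicalSpace Λ]
    [MeasurableSpace Λ] (P : Measure Ω) (χ : Ω → Measure Λ) (μ : Measure Λ)
    (K : Λ → Λ → ℂ) : Prop extends IsSimplePointProcess P χ where
  jointIntensity : ∀ k : ℕ, ∃ ρ : (Fin k → Λ) → ℝ≥0, IsJointIntensity P χ μ k ρ ∧
    ∀ᵐ x ∂(Measure.pi fun _ : Fin k => μ),
      ((ρ x : ℝ) : ℂ) = (Matrix.of fun i j => K (x i) (x j)).det

/-- The total number `χ(Λ)` of points, as an integer. The floor changes nothing, since `χ(Λ)` is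
an integer whenever it is finite. -/
noncomputable def totalCount {Ω Λ : Type*} [MeasurableSpace Λ] (χ : Ω → Measure Λ) (ω : Ω) : ℤ :=
  ⌊(χ ω Set.univ).toReal⌋

/-- Total variation distance of the integer-valued random variables `X` on `(Ω, P)` and `Y` on
`(Ω', P')`: the supremum over `A ⊆ ℤ` of `|P[X ∈ A] - P'[Y ∈ A]|`. -/
noncomputable def tvDist {Ω Ω' : Type*} [MeasurableSpace Ω] [MeasurableSpace Ω']
    (P : Measure Ω) (X : Ω → ℤ) (P' : Measure Ω') (Y : Ω' → ℤ) : ℝ :=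
  ⨆ A : Set ℤ, |P.real (X ⁻¹' A) - P'.real (Y ⁻¹' A)|

/-- `π`, a measure on `ℤ × ℤ`, is (the law of) a coupling of `X` and `Y`. -/
structure IsCoupling {Ω Ω' : Type*} [MeasurableSpace Ω] [MeasurableSpace Ω']
    (P : Measure Ω) (X : Ω → ℤ) (P' : Measure Ω') (Y : Ω' → ℤ) (π : Measure (ℤ × ℤ)) : Prop where
  isProbabilityMeasure : IsProbabilityMeasure π
  map_fst : π.map Prod.fst = P.map X
  map_snd : π.map Prod.snd = P'.map Y

/-- `L¹`-Wasserstein distance of the integer-valued random variables `X` and `Y`: the infimum of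
`E|Z₁ - Z₂|` over all couplings `(Z₁, Z₂)` of `X` and `Y`, as an element of `[0, ∞]`. -/
noncomputable def wassersteinOne {Ω Ω' : Type*} [MeasurableSpace Ω] [MeasurableSpace Ω']
    (P : Measure Ω) (X : Ω → ℤ) (P' : Measure Ω') (Y : Ω' → ℤ) : ℝ≥0∞ :=
  ⨅ (π : Measure (ℤ × ℤ)) (_ : IsCoupling P X P' Y π),
    ∫⁻ z, ENNReal.ofReal |(z.1 : ℝ) - (z.2 : ℝ)| ∂π

/-! ### Factorial moments as integrals of joint intensities -/

section FactorialMoments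

open Filter Topology

/-! The number of points of each process is a sum of independent Bernoulli variables whose
parameters are the eigenvalues of its kernel, so the theorem reduces to comparing the ordered
spectra of two Hermitian matrices.

Finite rank comes from the bound on the number of points. The integral of `ρ_k` is the `k`-th
factorial moment, which is zero for `k > N`; since `ρ_k ≥ 0`, all minors of order above `N` vanish
almost everywhere. Fixing a nonvanishing minor of maximal order `r ≤ N`, Schur complements write `K`
through the sections at its `r` points (`exists_isFiniteRankKernel`). The formula also holds almost
everywhere on the diagonal, which the `L²` class of `K` need not see but the determinants use.

Both kernels are then Hermitian matrices `A`, `A'` of rank at most `N` in one orthonormal family.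
Diagonalizing `A` and integrating the determinants gives the generating function `E (1 + t)^X = ∏ (1
+ t λᵢ)`. Its positivity for `t > -1` forces `λᵢ ∈ [0, 1]`, and it determines the law. Driving both
Bernoulli sums by the same uniform variables yields `W₁ ≤ ∑ |λᵢ - λ'ᵢ|`, with both spectra in
decreasing order. At most `N` terms are nonzero, so Cauchy–Schwarz and Hoffman–Wielandt bound the
sum by `√N` times the Frobenius norm of `A - A'`, which is the `L²` norm of the difference of the
kernels. Total variation is below `W₁` because distinct integers differ by at least `1`. -/

/-- A finite integer-valued measure with no multiple points is carried by its atoms. -/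
lemma ae_measure_singleton_eq_one {Λ : Type*} [TopologicalSpace Λ] [PolishSpace Λ]
    [MeasurableSpace Λ] [BorelSpace Λ] (ν : Measure Λ) [IsFiniteMeasure ν]
    (hint : ∀ A : Set Λ, MeasurableSet A → ∃ n : ℕ∞, ν A = (n : ℝ≥0∞))
    (hsimple : ∀ x, ν {x} ≤ 1) : ∀ᵐ x ∂ν, ν {x} = 1 := by
  let _ := TopologicalSpace.upgradeIsCompletelyMetrizable Λ
  -- Every neighbourhood of a point of the support has positive, hence at least unit, mass; outer
  -- regularity passes this to the singleton.
  filter_upwards [Measure.support_mem_ae (μ := ν)] with x hx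
  refine le_antisymm (hsimple x) ?_
  rw [Set.measure_eq_iInf_isOpen]
  refine le_iInf fun U => le_iInf fun hU => le_iInf fun hUo => ?_
  have hpos := (Measure.mem_support_iff_forall x).1 hx U (hUo.mem_nhds (hU rfl))
  obtain ⟨n, hn⟩ := hint U hUo.measurableSet
  rw [hn] at hpos ⊢
  have h0 : n ≠ 0 := by
    rintro rfl
    simp at hpos
  have h1 : (1 : ℕ∞) ≤ n := Order.one_le_iff_pos.2 (pos_iff_ne_zero.2 h0)
  exact_mod_cast h1

lemma measurableSet_setOf_injective {Λ : Type*} [MeasurableSpace Λ] [MeasurableEq Λ] (k : ℕ) :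
    MeasurableSet {x : Fin k → Λ | Function.Injective x} := by
  have : {x : Fin k → Λ | Function.Injective x} =
      ⋂ (i) (j) (_ : i ≠ j), {x | x i = x j}ᶜ := by
    ext x
    simp only [Set.mem_ofPred_eq, Set.mem_iInter, Set.mem_compl_iff]
    constructor
    · intro h i j hij hx
      exact hij (h hx)
    · intro h i j hx
      by_contra hij
      exact h i j hij hx
  rw [this]
  refine MeasurableSet.iInter fun i => MeasurableSet.iInter fun j => MeasurableSet.iInter fun _ => ?_
  exact (measurableSet_eq_fun (measurable_pi_apply i) (measurable_pi_apply j)).compl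

/-- The product measure of the set of tuples of distinct points is a falling factorial. -/
lemma pi_setOf_injective {Λ : Type*} [MeasurableSpace Λ] [MeasurableEq Λ]
    [MeasurableSingletonClass Λ] (ν : Measure Λ) [IsFiniteMeasure ν] (n : ℕ)
    (hn : ν Set.univ = n) (hatom : ∀ᵐ x ∂ν, ν {x} = 1) (k : ℕ) :
    (Measure.pi fun _ : Fin k => ν) {x | Function.Injective x} = n.descFactorial k := by
  induction k with
  | zero =>
    have : {x : Fin 0 → Λ | Function.Injective x} = Set.univ := by
      ext x
      simp [Function.injective_of_subsingleton]
    simp [this]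
  | succ k ih =>
    have hmp := measurePreserving_piFinSuccAbove (fun _ : Fin (k + 1) => ν) 0
    have hS : MeasurableSet {p : Λ × (Fin k → Λ) |
        p.1 ∉ Set.range p.2 ∧ Function.Injective p.2} := by
      have := (MeasurableEquiv.piFinSuccAbove (fun _ : Fin (k + 1) => Λ) 0).symm.measurable
        (measurableSet_setOf_injective (Λ := Λ) (k + 1))
      convert this using 1
      ext p
      simp only [Set.mem_ofPred_eq, Set.mem_preimage, ← Fin.cons_injective_iff]
      simp [MeasurableEquiv.piFinSuccAbove]
      rfl
    have hpre : {x : Fin (k + 1) → Λ | Function.Injective x} =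
        (MeasurableEquiv.piFinSuccAbove (fun _ : Fin (k + 1) => Λ) 0) ⁻¹'
          {p : Λ × (Fin k → Λ) | p.1 ∉ Set.range p.2 ∧ Function.Injective p.2} := by
      ext x
      have : x = Fin.cons (x 0) (fun i => x i.succ) := (Fin.cons_self_tail x).symm
      rw [Set.mem_ofPred_eq, this, Fin.cons_injective_iff]
      simp [MeasurableEquiv.piFinSuccAbove, Fin.tail]
    rw [hpre, hmp.measure_preimage hS.nullMeasurableSet, Measure.prod_apply_symm hS]
    have hae : ∀ᵐ y ∂(Measure.pi fun _ : Fin k => ν), ∀ i, ν {y i} = 1 := by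
      rw [ae_all_iff]
      intro i
      exact (Measure.quasiMeasurePreserving_eval (fun _ : Fin k => ν) i).ae hatom
    -- Removing `k` distinct unit atoms leaves mass `n - k`, the next factor of the falling
    -- factorial; subtraction in `ℝ≥0∞` truncates just as in `ℕ`.
    have hfib : ∀ᵐ y ∂(Measure.pi fun _ : Fin k => ν),
        ν ((fun x => (x, y)) ⁻¹' {p : Λ × (Fin k → Λ) |
          p.1 ∉ Set.range p.2 ∧ Function.Injective p.2}) =
        {y : Fin k → Λ | Function.Injective y}.indicator (fun _ => ((n - k : ℕ) : ℝ≥0∞)) y := by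
      filter_upwards [hae] with y hy
      by_cases hinj : Function.Injective y
      · rw [Set.indicator_of_mem (by exact hinj)]
        have : ((fun x => (x, y)) ⁻¹' {p : Λ × (Fin k → Λ) |
          p.1 ∉ Set.range p.2 ∧ Function.Injective p.2}) = (⋃ i, {y i})ᶜ := by
          ext x
          simp [hinj, eq_comm]
        have hrange : ν (⋃ i, {y i}) = k := by
          rw [measure_iUnion]
          · simp [hy]
          · intro i j hij
            simpa using fun h => hij (hinj h)
          · exact fun i => measurableSet_singleton _
        rw [this, measure_compl (MeasurableSet.iUnion fun i => measurableSet_singleton _)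
          (measure_ne_top _ _), hrange, hn, ENNReal.natCast_sub]
      · rw [Set.indicator_of_notMem (by exact hinj)]
        convert measure_empty (μ := ν)
        ext x
        simp [hinj]
    rw [lintegral_congr_ae hfib, lintegral_indicator (measurableSet_setOf_injective k),
      setLIntegral_const, ih, Nat.descFactorial_succ]
    push_cast
    rfl

/-- The first `n` coordinates of the binary code of a point; its fibres are a finite partition. -/
noncomputable def cellCode {Λ : Type*} [MeasurableSpace Λ] [MeasurableSpace.CountablyGenerated Λ]
    (n : ℕ) (x : Λ) : Fin n → Bool := fun i => MeasurableSpace.mapNatBool Λ x i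

section Cells

variable {Λ : Type*} [MeasurableSpace Λ] [MeasurableSpace.CountablyGenerated Λ]

lemma measurable_cellCode (n : ℕ) : Measurable (cellCode (Λ := Λ) n) :=
  measurable_pi_lambda _ fun i =>
    (measurable_pi_apply (i : ℕ)).comp (MeasurableSpace.measurable_mapNatBool Λ)

lemma measurableSet_cell (n : ℕ) (a : Fin n → Bool) :
    MeasurableSet (cellCode (Λ := Λ) n ⁻¹' {a}) :=
  measurable_cellCode n (measurableSet_singleton a)

/-- These boxes have pairwise disjoint sides, and only on such boxes does a joint intensity
prescribe anything. -/
lemma setOf_cellCode_injective_eq (k n : ℕ) :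
    {x : Fin k → Λ | Function.Injective fun i => cellCode n (x i)} =
      ⋃ a : Fin k ↪ (Fin n → Bool), Set.univ.pi fun i => cellCode n ⁻¹' {a i} := by
  ext x
  simp only [Set.mem_ofPred_eq, Set.mem_iUnion, Set.mem_pi, Set.mem_univ, true_imp_iff,
    Set.mem_preimage, Set.mem_singleton_iff]
  constructor
  · intro h
    exact ⟨⟨_, h⟩, fun i => rfl⟩
  · rintro ⟨a, ha⟩
    convert a.injective using 1
    exact funext ha

lemma pairwise_disjoint_box (k n : ℕ) :
    Pairwise (Function.onFun Disjoint fun a : Fin k ↪ (Fin n → Bool) =>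
      Set.univ.pi fun i => cellCode (Λ := Λ) n ⁻¹' {a i}) := by
  intro a b hab
  rw [Function.onFun, Set.disjoint_left]
  intro x hx hy
  apply hab
  ext1 i
  exact (hx i trivial).symm.trans (hy i trivial)

lemma measurableSet_box (k n : ℕ) (a : Fin k ↪ (Fin n → Bool)) :
    MeasurableSet (Set.univ.pi fun i => cellCode (Λ := Λ) n ⁻¹' {a i}) :=
  MeasurableSet.univ_pi fun i => measurableSet_cell n (a i)

lemma monotone_setOf_cellCode_injective (k : ℕ) :
    Monotone fun n => {x : Fin k → Λ | Function.Injective fun i => cellCode n (x i)} := by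
  intro n m hnm x hx i j hij
  refine hx (funext fun l => ?_)
  exact congrFun hij (Fin.castLE hnm l)

/-- Codes separate points, and a tuple has finitely many pairs, so one code length separates them
all. -/
lemma iUnion_setOf_cellCode_injective [MeasurableSpace.SeparatesPoints Λ] (k : ℕ) :
    ⋃ n, {x : Fin k → Λ | Function.Injective fun i => cellCode n (x i)} =
      {x | Function.Injective x} := by
  ext x
  simp only [Set.mem_iUnion, Set.mem_ofPred_eq]
  constructor
  · rintro ⟨n, hn⟩ i j hij
    exact hn (by simp [hij])
  · intro h
    have hsep : ∀ p : Fin k × Fin k, p.1 ≠ p.2 → ∃ l : ℕ,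
        MeasurableSpace.mapNatBool Λ (x p.1) l ≠ MeasurableSpace.mapNatBool Λ (x p.2) l := by
      intro p hp
      by_contra! hcon
      exact hp (h (MeasurableSpace.injective_mapNatBool Λ (funext hcon)))
    choose! l hl using hsep
    refine ⟨(Finset.univ.sup l) + 1, fun i j hij => ?_⟩
    by_contra hne
    have hlt : l (i, j) < Finset.univ.sup l + 1 :=
      Nat.lt_succ_of_le (Finset.le_sup (f := l) (Finset.mem_univ (i, j)))
    exact hl (i, j) hne (congrFun hij ⟨l (i, j), hlt⟩)

lemma sum_measure_box (k n : ℕ) (m : Measure (Fin k → Λ)) :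
    ∑ a : Fin k ↪ (Fin n → Bool), m (Set.univ.pi fun i => cellCode (Λ := Λ) n ⁻¹' {a i}) =
      m {x : Fin k → Λ | Function.Injective fun i => cellCode n (x i)} := by
  rw [setOf_cellCode_injective_eq, measure_iUnion (pairwise_disjoint_box k n)
    (measurableSet_box k n), tsum_fintype]

/-- Exhaustion of the set of distinct tuples by boxes over the cells. -/
lemma tendsto_measure_setOf_cellCode_injective [MeasurableSpace.SeparatesPoints Λ] (k : ℕ)
    (m : Measure (Fin k → Λ)) :
    Tendsto (fun n => ∑ a : Fin k ↪ (Fin n → Bool),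
      m (Set.univ.pi fun i => cellCode (Λ := Λ) n ⁻¹' {a i})) atTop
      (𝓝 (m {x | Function.Injective x})) := by
  simp_rw [sum_measure_box]
  rw [← iUnion_setOf_cellCode_injective]
  exact tendsto_measure_iUnion_atTop (monotone_setOf_cellCode_injective k)

lemma monotone_sum_box (k : ℕ) (m : Measure (Fin k → Λ)) :
    Monotone (fun n => ∑ a : Fin k ↪ (Fin n → Bool),
      m (Set.univ.pi fun i => cellCode (Λ := Λ) n ⁻¹' {a i})) := by
  simp_rw [sum_measure_box]
  exact fun _ _ h => measure_mono (monotone_setOf_cellCode_injective k h)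

end Cells

/-- If the joint intensity vanishes on tuples with repetitions, its integral is the factorial
moment of the total number of points. -/
lemma lintegral_descFactorial_eq {Ω Λ : Type*} [MeasurableSpace Ω] [TopologicalSpace Λ]
    [PolishSpace Λ] [MeasurableSpace Λ] [BorelSpace Λ] {P : Measure Ω} {χ : Ω → Measure Λ}
    {μ : Measure Λ} (hχ : IsSimplePointProcess P χ) {k : ℕ} {ρ : (Fin k → Λ) → ℝ≥0}
    (hρ : IsJointIntensity P χ μ k ρ)
    (hρ0 : ∀ᵐ x ∂(Measure.pi fun _ : Fin k => μ), ¬ Function.Injective x → ρ x = 0)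
    (X : Ω → ℕ) (hX : ∀ᵐ ω ∂P, χ ω Set.univ = X ω) :
    ∫⁻ ω, ((X ω).descFactorial k : ℝ≥0∞) ∂P =
      ∫⁻ x, (ρ x : ℝ≥0∞) ∂(Measure.pi fun _ : Fin k => μ) := by
  set m := (Measure.pi fun _ : Fin k => μ).withDensity (fun x => (ρ x : ℝ≥0∞)) with hm
  have hmeas : ∀ A, MeasurableSet A → Measurable fun ω => χ ω A := fun A hA =>
    (Measure.measurable_coe hA).comp hχ.measurable
  have hdisj : ∀ n (a : Fin k ↪ (Fin n → Bool)),
      ∫⁻ ω, ∏ i, χ ω (cellCode n ⁻¹' {a i}) ∂P =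
        m (Set.univ.pi fun i => cellCode (Λ := Λ) n ⁻¹' {a i}) := by
    intro n a
    rw [hρ.lintegral_prod_eq _ (fun i => measurableSet_cell n (a i)), hm,
      withDensity_apply _ (measurableSet_box k n a)]
    intro i j hij
    rw [Set.disjoint_left]
    intro x hx hy
    exact hij (a.injective (hx.symm.trans hy))
  have hright := tendsto_measure_setOf_cellCode_injective k m
  have hmsum : ∀ n, ∑ a : Fin k ↪ (Fin n → Bool),
      m (Set.univ.pi fun i => cellCode (Λ := Λ) n ⁻¹' {a i}) =
      ∫⁻ ω, ∑ a : Fin k ↪ (Fin n → Bool), ∏ i, χ ω (cellCode n ⁻¹' {a i}) ∂P := by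
    intro n
    rw [lintegral_finsetSum]
    · simp_rw [hdisj]
    · intro a _
      exact Finset.measurable_prod _ fun i _ => hmeas _ (measurableSet_cell n (a i))
  simp_rw [hmsum] at hright
  -- For fixed `ω` the box sums are masses under the product measure of `χ ω`, increasing to that of
  -- the distinct tuples. Monotone convergence then carries the limit through the expectation.
  have hlim : ∀ᵐ ω ∂P, (Monotone fun n => ∑ a : Fin k ↪ (Fin n → Bool),
        ∏ i, χ ω (cellCode n ⁻¹' {a i})) ∧
      Tendsto (fun n => ∑ a : Fin k ↪ (Fin n → Bool), ∏ i, χ ω (cellCode n ⁻¹' {a i}))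
        atTop (𝓝 ((X ω).descFactorial k : ℝ≥0∞)) := by
    filter_upwards [hX, hχ.integerValued, hχ.simple] with ω h1 h2 h3
    have : IsFiniteMeasure (χ ω) := ⟨by rw [h1]; exact ENNReal.natCast_lt_top _⟩
    have hbox : ∀ n (a : Fin k ↪ (Fin n → Bool)), ∏ i, χ ω (cellCode n ⁻¹' {a i}) =
        (Measure.pi fun _ : Fin k => χ ω)
          (Set.univ.pi fun i => cellCode (Λ := Λ) n ⁻¹' {a i}) := by
      intro n a
      rw [Measure.pi_pi]
    simp_rw [hbox]
    refine ⟨monotone_sum_box k _, ?_⟩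
    rw [← pi_setOf_injective (χ ω) (X ω) h1 (ae_measure_singleton_eq_one _ h2 h3) k]
    exact tendsto_measure_setOf_cellCode_injective k _
  have hleft := lintegral_tendsto_of_tendsto_of_monotone (μ := P)
    (f := fun n ω => ∑ a : Fin k ↪ (Fin n → Bool), ∏ i, χ ω (cellCode n ⁻¹' {a i}))
    (F := fun ω => ((X ω).descFactorial k : ℝ≥0∞))
    (fun n => (Finset.measurable_sum _ fun a _ => Finset.measurable_prod _ fun i _ =>
      hmeas _ (measurableSet_cell n (a i))).aemeasurable)
    (hlim.mono fun ω h => h.1) (hlim.mono fun ω h => h.2)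
  rw [tendsto_nhds_unique hleft hright, hm,
    withDensity_apply _ (measurableSet_setOf_injective k), ← lintegral_indicator
      (measurableSet_setOf_injective k)]
  refine lintegral_congr_ae ?_
  filter_upwards [hρ0] with x hx
  by_cases h : Function.Injective x
  · rw [Set.indicator_of_mem (by exact h)]
  · rw [Set.indicator_of_notMem (by exact h), hx h]
    simp

end FactorialMoments

/-! ### Vanishing minors force finite rank -/

section FiniteRank

open Matrix

/-- Almost every tuple splits into two independent blocks. -/
lemma ae_ae_sumElim {Λ : Type*} [MeasurableSpace Λ] (μ : Measure Λ) [SigmaFinite μ] {r l : ℕ}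
    {p : (Fin (r + l) → Λ) → Prop} (h : ∀ᵐ x ∂(Measure.pi fun _ : Fin (r + l) => μ), p x) :
    ∀ᵐ y ∂(Measure.pi fun _ : Fin r => μ), ∀ᵐ w ∂(Measure.pi fun _ : Fin l => μ),
      p fun i => Sum.elim y w (finSumFinEquiv.symm i) := by
  have h1 := measurePreserving_sumPiEquivProdPi_symm (fun _ : Fin r ⊕ Fin l => μ)
  have h2 := measurePreserving_piCongrLeft (fun _ : Fin (r + l) => μ) (finSumFinEquiv (m := r) (n := l))
  have h3 := (h2.comp h1).quasiMeasurePreserving.ae h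
  filter_upwards [Measure.ae_ae_of_ae_prod h3] with y hy
  filter_upwards [hy] with w hw
  convert hw using 1
  ext i
  obtain ⟨j, rfl⟩ := finSumFinEquiv.surjective i
  rw [Function.comp_apply, MeasurableEquiv.coe_piCongrLeft, Equiv.piCongrLeft_apply_apply,
    Equiv.symm_apply_apply]
  cases j <;> rfl

/-- What remains of the kernel `K` after the Schur complement of the points `y`. -/
noncomputable def schurKernel {Λ : Type*} (K : Λ → Λ → ℂ) {r : ℕ} (y : Fin r → Λ)
    (x z : Λ) : ℂ :=
  K x z - ∑ b, (∑ a, K x (y a) * (Matrix.of fun i j => K (y i) (y j))⁻¹ a b) * K (y b) z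

/-- The determinant of a block matrix is that of the invertible corner times that of its Schur
complement. -/
lemma det_schurKernel_eq_zero {Λ : Type*} (K : Λ → Λ → ℂ) {r l : ℕ} (y : Fin r → Λ)
    (w : Fin l → Λ) (hy : (Matrix.of fun i j => K (y i) (y j)).det ≠ 0)
    (h : (Matrix.of fun i j : Fin (r + l) => K (Sum.elim y w (finSumFinEquiv.symm i))
      (Sum.elim y w (finSumFinEquiv.symm j))).det = 0) :
    (Matrix.of fun i j => schurKernel K y (w i) (w j)).det = 0 := by
  set M : Matrix (Fin r) (Fin r) ℂ := Matrix.of fun i j => K (y i) (y j) with hM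
  have hu : IsUnit M.det := isUnit_iff_ne_zero.2 hy
  let _ : Invertible M := M.invertibleOfIsUnitDet hu
  have hblock : (Matrix.of fun i j : Fin (r + l) => K (Sum.elim y w (finSumFinEquiv.symm i))
      (Sum.elim y w (finSumFinEquiv.symm j))) =
      (fromBlocks M (Matrix.of fun i j => K (y i) (w j)) (Matrix.of fun i j => K (w i) (y j))
        (Matrix.of fun i j => K (w i) (w j))).submatrix finSumFinEquiv.symm
          finSumFinEquiv.symm := by
    ext i j
    simp only [of_apply, submatrix_apply]
    rcases finSumFinEquiv.symm i with a | a <;> rcases finSumFinEquiv.symm j with b | b <;> rfl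
  rw [hblock, det_submatrix_equiv_self, det_fromBlocks₁₁, mul_eq_zero, or_iff_right hy] at h
  rw [← h]
  congr 1

/-- Hermitian symmetry survives the Schur complement; it turns the product of off-diagonal entries
in a `2 × 2` minor into a squared modulus. -/
lemma schurKernel_conj {Λ : Type*} (K : Λ → Λ → ℂ)
    (hK : ∀ x y, K x y = starRingEnd ℂ (K y x)) {r : ℕ} (y : Fin r → Λ) (x z : Λ) :
    schurKernel K y z x = starRingEnd ℂ (schurKernel K y x z) := by
  have hH : (Matrix.of fun i j => K (y i) (y j))⁻¹.IsHermitian := by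
    refine IsHermitian.inv ?_
    ext i j
    exact (hK _ _).symm
  simp only [schurKernel, map_sub, map_sum, map_mul, Finset.sum_mul]
  rw [← hK, Finset.sum_comm]
  congr 1
  refine Finset.sum_congr rfl fun a _ => Finset.sum_congr rfl fun b _ => ?_
  rw [← hK, ← hK]
  have : starRingEnd ℂ ((Matrix.of fun i j => K (y i) (y j))⁻¹ b a) =
    (Matrix.of fun i j => K (y i) (y j))⁻¹ a b := hH.apply a b
  rw [this]
  ring

/-- `K` agrees almost everywhere, and almost everywhere on the diagonal, with the kernel
`∑ u_a(x) H_{ab} conj (u_b(z))`. -/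
structure IsFiniteRankKernel {Λ : Type*} [MeasurableSpace Λ] (μ : Measure Λ) (K : Λ → Λ → ℂ)
    {ι : Type*} [Fintype ι] (u : ι → Λ → ℂ) (H : Matrix ι ι ℂ) : Prop where
  isHermitian : H.IsHermitian
  memLp : ∀ a, MemLp (u a) 2 μ
  diag : ∀ᵐ x ∂μ, K x x = ∑ a, ∑ b, u a x * H a b * starRingEnd ℂ (u b x)
  offDiag : ∀ᵐ p ∂(μ.prod μ), K p.1 p.2 = ∑ a, ∑ b, u a p.1 * H a b * starRingEnd ℂ (u b p.2)

/-- A Hermitian kernel whose determinants of order greater than `N` vanish has rank at most `N`. -/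
lemma exists_isFiniteRankKernel {Λ : Type*} [MeasurableSpace Λ] (μ : Measure Λ) [SigmaFinite μ]
    (K : Λ → Λ → ℂ) (hK : ∀ x y, K x y = starRingEnd ℂ (K y x))
    (hL2 : MemLp (fun p : Λ × Λ => K p.1 p.2) 2 (μ.prod μ)) (N : ℕ)
    (hdet : ∀ k, N < k → ∀ᵐ x ∂(Measure.pi fun _ : Fin k => μ),
      (Matrix.of fun i j => K (x i) (x j)).det = 0) :
    ∃ r ≤ N, ∃ (u : Fin r → Λ → ℂ) (H : Matrix (Fin r) (Fin r) ℂ),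
      IsFiniteRankKernel μ K u H := by
  classical
  let Q : ℕ → Prop := fun k => ¬ ∀ᵐ x ∂(Measure.pi fun _ : Fin k => μ),
      (Matrix.of fun i j => K (x i) (x j)).det = 0
  -- The empty minor is `1`, so a maximal order `r` exists, possibly `0`.
  have hQ0 : Q 0 := by
    intro h
    simp only [det_fin_zero, one_ne_zero] at h
    rw [Measure.pi_of_empty, ae_dirac_eq] at h
    simp at h
  set r := Nat.findGreatest Q N with hr
  have hQr : Q r := Nat.findGreatest_spec (Nat.zero_le N) hQ0
  have hbig : ∀ k, r < k → ∀ᵐ x ∂(Measure.pi fun _ : Fin k => μ),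
      (Matrix.of fun i j => K (x i) (x j)).det = 0 := by
    intro k hk
    rcases le_or_gt k N with hkN | hkN
    · exact not_not.1 (Nat.findGreatest_is_greatest hk hkN)
    · exact hdet k hkN
  have hsec : ∀ᵐ z ∂μ, MemLp (fun x => K x z) 2 μ := by
    have hae := hL2.1.prodMk_left
    have hint := ((memLp_two_iff_integrable_sq_norm hL2.1).1 hL2).prod_right_ae
    filter_upwards [hae, hint] with z h1 h2
    have h3 : MemLp (fun x => K z x) 2 μ := (memLp_two_iff_integrable_sq_norm h1).2 h2
    have h4 := h3.star
    refine h4.congr_norm ?_ ?_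
    · refine h4.1.congr (Filter.Eventually.of_forall fun x => ?_)
      exact (hK x z).symm
    · refine Filter.Eventually.of_forall fun x => ?_
      simp [hK x z]
  have hsec' : ∀ᵐ y ∂(Measure.pi fun _ : Fin r => μ), ∀ i, MemLp (fun x => K x (y i)) 2 μ := by
    rw [ae_all_iff]
    intro i
    exact (Measure.quasiMeasurePreserving_eval (fun _ : Fin r => μ) i).ae hsec
  have h1 := ae_ae_sumElim μ (hbig (r + 1) (by lia))
  have h2 := ae_ae_sumElim μ (hbig (r + 2) (by lia))
  -- The minor of order `r` is nonzero on a non-null set, which meets the full-measure set where the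
  -- other conditions hold.
  obtain ⟨y, hy, hy1, hy2, hymem⟩ := (Filter.Frequently.and_eventually
    (Filter.not_eventually.1 hQr) (h1.and (h2.and hsec'))).exists
  have hH : (Matrix.of fun i j => K (y i) (y j))⁻¹.IsHermitian := by
    refine IsHermitian.inv ?_
    ext i j
    exact (hK _ _).symm
  have hform : ∀ x z, schurKernel K y x z = 0 → K x z = ∑ a, ∑ b, K x (y a) *
      (Matrix.of fun i j => K (y i) (y j))⁻¹ a b * starRingEnd ℂ (K z (y b)) := by
    intro x z h
    rw [schurKernel, sub_eq_zero] at h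
    rw [h]
    simp only [Finset.sum_mul]
    rw [Finset.sum_comm]
    simp_rw [← hK]
  have hdiag : ∀ᵐ x ∂μ, schurKernel K y x x = 0 := by
    have hmp := (measurePreserving_funUnique μ (Fin 1)).symm
    filter_upwards [hmp.quasiMeasurePreserving.ae hy1] with x hx
    have := det_schurKernel_eq_zero K y _ hy hx
    rw [det_fin_one] at this
    exact this
  refine ⟨r, Nat.findGreatest_le N, fun a x => K x (y a), (Matrix.of fun i j => K (y i) (y j))⁻¹,
    hH, hymem, ?_, ?_⟩
  · filter_upwards [hdiag] with x hx
    exact hform x x hx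
  · have hmp := (measurePreserving_finTwoArrow μ).symm
    filter_upwards [hmp.quasiMeasurePreserving.ae hy2,
      Measure.quasiMeasurePreserving_fst.ae hdiag] with p hp hp1
    apply hform
    have := det_schurKernel_eq_zero K y _ hy hp
    rw [det_fin_two] at this
    change schurKernel K y p.1 p.1 * schurKernel K y p.2 p.2 -
      schurKernel K y p.1 p.2 * schurKernel K y p.2 p.1 = 0 at this
    -- One vanishing diagonal entry reduces the `2 × 2` minor to minus a squared modulus.
    rw [hp1, zero_mul, zero_sub, neg_eq_zero, schurKernel_conj K hK y p.1 p.2,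
      Complex.mul_conj] at this
    simpa using this

end FiniteRank

/-! ### Matrices of kernels in orthonormal families -/

section Orthonormal

open Matrix ComplexConjugate

/-- The functions `e` form an orthonormal family in `L²(μ)`. -/
structure IsOrthonormalFamily {Λ : Type*} [MeasurableSpace Λ] (μ : Measure Λ)
    {ι : Type*} [DecidableEq ι] (e : ι → Λ → ℂ) : Prop where
  memLp : ∀ a, MemLp (e a) 2 μ
  integral_eq : ∀ a b, ∫ x, e a x * conj (e b x) ∂μ = if a = b then 1 else 0

lemma IsOrthonormalFamily.integrable {Λ : Type*} [MeasurableSpace Λ] {μ : Measure Λ}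
    {ι : Type*} [DecidableEq ι] {e : ι → Λ → ℂ} (he : IsOrthonormalFamily μ e) (a b : ι) :
    Integrable (fun x => e a x * conj (e b x)) μ :=
  (he.memLp a).integrable_mul (he.memLp b).star

/-- Finitely many square-integrable functions lie in the span of an orthonormal family. -/
lemma exists_isOrthonormalFamily {Λ : Type*} [MeasurableSpace Λ] (μ : Measure Λ)
    {ι : Type*} [Fintype ι] (u : ι → Λ → ℂ) (hu : ∀ i, MemLp (u i) 2 μ) :
    ∃ (m : ℕ) (e : Fin m → Λ → ℂ), IsOrthonormalFamily μ e ∧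
      ∃ C : Matrix ι (Fin m) ℂ, ∀ i, ∀ᵐ x ∂μ, u i x = ∑ b, C i b * e b x := by
  let S : Submodule ℂ (Lp ℂ 2 μ) := Submodule.span ℂ (Set.range fun i => (hu i).toLp)
  have hfin : FiniteDimensional ℂ S := FiniteDimensional.span_of_finite ℂ (Set.finite_range _)
  let B := stdOrthonormalBasis ℂ S
  refine ⟨_, fun b => ((B b : Lp ℂ 2 μ) : Λ → ℂ), ⟨fun b => Lp.memLp _, fun a b => ?_⟩, ?_⟩
  -- The inner product is conjugate-linear in its first argument, hence the order `b a`.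
  · have h := orthonormal_iff_ite.1 B.orthonormal b a
    rw [Submodule.coe_inner, L2.inner_def] at h
    simp only [eq_comm (a := b)] at h
    rw [← h]
    simp [RCLike.inner_apply]
  · have hmem : ∀ i, (hu i).toLp ∈ S := fun i => Submodule.subset_span ⟨i, rfl⟩
    refine ⟨fun i b => B.repr ⟨_, hmem i⟩ b, fun i => ?_⟩
    have hsum : (hu i).toLp = ∑ b, B.repr ⟨_, hmem i⟩ b • (B b : Lp ℂ 2 μ) := by
      have := congrArg (Submodule.subtype S) (B.sum_repr ⟨_, hmem i⟩)
      rw [map_sum] at this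
      exact this.symm
    have h1 := (hu i).coeFn_toLp
    have h2 : ∀ᵐ x ∂μ, ((∑ b, B.repr ⟨_, hmem i⟩ b • (B b : Lp ℂ 2 μ) : Lp ℂ 2 μ) : Λ → ℂ) x =
        ∑ b, ((B.repr ⟨_, hmem i⟩ b • (B b : Lp ℂ 2 μ) : Lp ℂ 2 μ) : Λ → ℂ) x := by
      filter_upwards [Lp.coeFn_finsetSum Finset.univ
        (fun b => B.repr ⟨_, hmem i⟩ b • (B b : Lp ℂ 2 μ))] with x hx
      rw [hx, Finset.sum_apply]
    have h3 : ∀ᵐ x ∂μ, ∀ b, ((B.repr ⟨_, hmem i⟩ b • (B b : Lp ℂ 2 μ) : Lp ℂ 2 μ) : Λ → ℂ) x =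
        B.repr ⟨_, hmem i⟩ b * (B b : Lp ℂ 2 μ) x := by
      rw [ae_all_iff]
      intro b
      filter_upwards [Lp.coeFn_smul (B.repr ⟨_, hmem i⟩ b) (B b : Lp ℂ 2 μ)] with x hx
      rw [hx]
      rfl
    rw [← hsum] at h2
    filter_upwards [h1, h2, h3] with x hx1 hx2 hx3
    rw [← hx1, hx2]
    exact Finset.sum_congr rfl fun b _ => hx3 b

lemma bilinear_expand {ι κ : Type*} [Fintype ι] [Fintype κ] (H : Matrix ι ι ℂ)
    (C : Matrix ι κ ℂ) (v w : κ → ℂ) :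
    ∑ a, ∑ b, (∑ c, C a c * v c) * H a b * conj (∑ d, C b d * w d) =
      ∑ c, ∑ d, v c * (Cᵀ * H * C.map conj) c d * conj (w d) := by
  have h : ∀ (G : Matrix ι ι ℂ) (p q : ι → ℂ), ∑ a, ∑ b, p a * G a b * q b = p ⬝ᵥ (G *ᵥ q) := by
    intro G p q
    simp [dotProduct, mulVec, Finset.mul_sum, mul_assoc]
  have h' : ∀ (G : Matrix κ κ ℂ) (p q : κ → ℂ), ∑ a, ∑ b, p a * G a b * q b = p ⬝ᵥ (G *ᵥ q) := by
    intro G p q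
    simp [dotProduct, mulVec, Finset.mul_sum, mul_assoc]
  rw [h H (fun a => ∑ c, C a c * v c) (fun b => conj (∑ d, C b d * w d)),
    h' _ v fun d => conj (w d)]
  have h1 : (fun a => ∑ c, C a c * v c) = C *ᵥ v := rfl
  have h2 : (fun b => conj (∑ d, C b d * w d)) = C.map conj *ᵥ fun d => conj (w d) := by
    ext b
    simp [mulVec, dotProduct]
  rw [h1, h2, ← mulVec_mulVec, ← mulVec_mulVec, dotProduct_mulVec v, vecMul_transpose]

/-- Substituting `u = C e` acts on `H` by congruence. The first variable enters linearly and the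
second conjugate-linearly, hence `Cᵀ` on the left and the conjugate of `C` on the right. -/
lemma IsFiniteRankKernel.change {Λ : Type*} [MeasurableSpace Λ] {μ : Measure Λ} [SFinite μ]
    {K : Λ → Λ → ℂ} {ι κ : Type*} [Fintype ι] [Fintype κ] {u : ι → Λ → ℂ} {H : Matrix ι ι ℂ}
    (h : IsFiniteRankKernel μ K u H) (e : κ → Λ → ℂ) (he : ∀ c, MemLp (e c) 2 μ)
    (C : Matrix ι κ ℂ) (hC : ∀ i, ∀ᵐ x ∂μ, u i x = ∑ b, C i b * e b x) :
    IsFiniteRankKernel μ K e (Cᵀ * H * C.map conj) := by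
  rw [← ae_all_iff] at hC
  refine ⟨?_, he, ?_, ?_⟩
  · have : C.map conj = Cᵀᴴ := by
      ext i j
      rfl
    rw [this]
    exact isHermitian_mul_mul_conjTranspose _ h.isHermitian
  · filter_upwards [h.diag, hC] with x h1 h2
    rw [h1, ← bilinear_expand]
    simp_rw [h2]
  · filter_upwards [h.offDiag, Measure.quasiMeasurePreserving_fst.ae hC,
      Measure.quasiMeasurePreserving_snd.ae hC] with p h1 h2 h3
    rw [h1, ← bilinear_expand]
    simp_rw [h2, h3]

lemma IsOrthonormalFamily.unitary {Λ : Type*} [MeasurableSpace Λ] {μ : Measure Λ} {ι : Type*}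
    [Fintype ι] [DecidableEq ι] {e : ι → Λ → ℂ} (he : IsOrthonormalFamily μ e)
    (U : Matrix ι ι ℂ) (hU : star U * U = 1) :
    IsOrthonormalFamily μ fun a x => ∑ b, U b a * e b x := by
  refine ⟨fun a => memLp_finsetSum _ fun b _ => (he.memLp b).const_mul _, fun a b => ?_⟩
  have hexp : ∀ x, (∑ c, U c a * e c x) * conj (∑ d, U d b * e d x) =
      ∑ c, ∑ d, U c a * conj (U d b) * (e c x * conj (e d x)) := by
    intro x
    rw [map_sum, Finset.sum_mul_sum]
    refine Finset.sum_congr rfl fun c _ => Finset.sum_congr rfl fun d _ => ?_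
    rw [map_mul]
    ring
  simp_rw [hexp]
  rw [integral_finsetSum _ fun c _ => integrable_finsetSum _ fun d _ =>
    (he.integrable c d).const_mul _]
  have : ∀ c, ∫ x, ∑ d, U c a * conj (U d b) * (e c x * conj (e d x)) ∂μ =
      U c a * conj (U c b) := by
    intro c
    rw [integral_finsetSum _ fun d _ => (he.integrable c d).const_mul _]
    simp_rw [integral_const_mul, he.integral_eq]
    simp
  simp_rw [this]
  have h := congrFun (congrFun hU b) a
  rw [Matrix.mul_apply, Matrix.one_apply] at h
  simp only [eq_comm (a := a)]
  rw [← h]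
  refine Finset.sum_congr rfl fun c _ => ?_
  rw [mul_comm]
  rfl

/-- Diagonalization of a finite rank kernel. -/
lemma IsFiniteRankKernel.diagonalize {Λ : Type*} [MeasurableSpace Λ] {μ : Measure Λ} [SFinite μ]
    {K : Λ → Λ → ℂ} {ι : Type*} [Fintype ι] [DecidableEq ι] {e : ι → Λ → ℂ} {A : Matrix ι ι ℂ}
    (h : IsFiniteRankKernel μ K e A) (he : IsOrthonormalFamily μ e) :
    ∃ φ : ι → Λ → ℂ, IsOrthonormalFamily μ φ ∧
      IsFiniteRankKernel μ K φ (diagonal fun i => (h.isHermitian.eigenvalues i : ℂ)) := by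
  set U : Matrix ι ι ℂ := h.isHermitian.eigenvectorUnitary.1 with hUdef
  have hU1 : star U * U = 1 := Unitary.coe_star_mul_self _
  have hU2 : U * star U = 1 := Unitary.coe_mul_star_self _
  have hφ := he.unitary U hU1
  refine ⟨_, hφ, ?_⟩
  -- The new functions are `φ_a = ∑ U_{ba} e_b`; unitarity inverts this to `e_i = ∑ conj (U_{ia})
  -- φ_a`.
  have hch := h.change _ hφ.memLp (U.map conj) (fun i => Filter.Eventually.of_forall fun x => ?_)
  · have hmat : (U.map conj)ᵀ * A * (U.map conj).map conj =
        diagonal fun i => (h.isHermitian.eigenvalues i : ℂ) := by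
      have h1 : (U.map conj)ᵀ = star U := rfl
      have h2 : (U.map conj).map conj = U := by
        ext i j
        simp
      rw [h1, h2]
      have h3 := h.isHermitian.conjStarAlgAut_star_eigenvectorUnitary
      rw [Unitary.conjStarAlgAut_star_apply] at h3
      exact h3
    rw [hmat] at hch
    exact hch
  · simp only [map_apply, Finset.mul_sum]
    rw [Finset.sum_comm]
    have h1 : ∀ b, ∑ a, conj (U i a) * (U b a * e b x) = (U * star U) b i * e b x := by
      intro b
      rw [Matrix.mul_apply, Finset.sum_mul]
      refine Finset.sum_congr rfl fun a _ => ?_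
      rw [star_apply]
      simp only [RCLike.star_def]
      ring
    simp_rw [h1, hU2, one_apply]
    simp

/-- The Hilbert–Schmidt norm of a finite rank kernel is the Frobenius norm of its matrix. -/
lemma IsOrthonormalFamily.integral_norm_sq {Λ : Type*} [MeasurableSpace Λ] {μ : Measure Λ}
    [SFinite μ] {ι : Type*} [Fintype ι] [DecidableEq ι] {e : ι → Λ → ℂ}
    (he : IsOrthonormalFamily μ e) (D : Matrix ι ι ℂ) :
    ∫ p, ‖∑ a, ∑ b, e a p.1 * D a b * conj (e b p.2)‖ ^ 2 ∂(μ.prod μ) =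
      ∑ a, ∑ b, ‖D a b‖ ^ 2 := by
  have hint : ∀ a b c d, Integrable (fun p : Λ × Λ => D a b * conj (D c d) *
      ((e a p.1 * conj (e c p.1)) * (e d p.2 * conj (e b p.2)))) (μ.prod μ) := fun a b c d =>
    ((he.integrable a c).mul_prod (he.integrable d b)).const_mul _
  have hpt : ∀ p : Λ × Λ, ((‖∑ a, ∑ b, e a p.1 * D a b * conj (e b p.2)‖ ^ 2 : ℝ) : ℂ) =
      ∑ a, ∑ b, ∑ c, ∑ d, D a b * conj (D c d) *
      ((e a p.1 * conj (e c p.1)) * (e d p.2 * conj (e b p.2))) := by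
    intro p
    push_cast
    rw [← Complex.mul_conj', map_sum, Finset.sum_mul_sum]
    simp_rw [map_sum, Finset.sum_mul_sum]
    refine Finset.sum_congr rfl fun a _ => ?_
    rw [Finset.sum_comm]
    refine Finset.sum_congr rfl fun b _ => Finset.sum_congr rfl fun c _ =>
      Finset.sum_congr rfl fun d _ => ?_
    simp only [map_mul, Complex.conj_conj]
    ring
  have hval : ∀ a b c d, ∫ p : Λ × Λ, D a b * conj (D c d) *
      ((e a p.1 * conj (e c p.1)) * (e d p.2 * conj (e b p.2))) ∂(μ.prod μ) =
      if a = c then (if d = b then D a b * conj (D c d) else 0) else 0 := by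
    intro a b c d
    rw [integral_const_mul, integral_prod_mul (fun x => e a x * conj (e c x))
      (fun x => e d x * conj (e b x)), he.integral_eq, he.integral_eq]
    split_ifs <;> simp
  rw [← Complex.ofReal_inj, ← integral_complex_ofReal]
  simp_rw [hpt]
  rw [integral_finsetSum _ fun a _ => integrable_finsetSum _ fun b _ => integrable_finsetSum _
    fun c _ => integrable_finsetSum _ fun d _ => hint a b c d]
  push_cast
  refine Finset.sum_congr rfl fun a _ => ?_
  rw [integral_finsetSum _ fun b _ => integrable_finsetSum _
    fun c _ => integrable_finsetSum _ fun d _ => hint a b c d]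
  refine Finset.sum_congr rfl fun b _ => ?_
  rw [integral_finsetSum _ fun c _ => integrable_finsetSum _ fun d _ => hint a b c d]
  have : ∀ c, ∫ p : Λ × Λ, ∑ d, D a b * conj (D c d) *
      ((e a p.1 * conj (e c p.1)) * (e d p.2 * conj (e b p.2))) ∂(μ.prod μ) =
      if a = c then D a b * conj (D c b) else 0 := by
    intro c
    rw [integral_finsetSum _ fun d _ => hint a b c d]
    simp_rw [hval]
    split_ifs <;> simp
  simp_rw [this]
  simp [Complex.mul_conj']

end Orthonormal

/-! ### Integrals of determinants -/

section DeterminantIntegral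

open Matrix ComplexConjugate

/-- A property of almost every pair, and almost every diagonal point, holds for all pairs of
coordinates of almost every tuple. -/
lemma ae_pi_forall_pair {Λ : Type*} [MeasurableSpace Λ] (μ : Measure Λ) [SigmaFinite μ]
    {p : Λ → Λ → Prop} (hdiag : ∀ᵐ x ∂μ, p x x) (hoff : ∀ᵐ q ∂(μ.prod μ), p q.1 q.2) (k : ℕ) :
    ∀ᵐ x ∂(Measure.pi fun _ : Fin k => μ), ∀ i j, p (x i) (x j) := by
  rw [ae_all_iff]
  intro i
  rw [ae_all_iff]
  intro j
  by_cases hij : i = j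
  · subst hij
    exact (Measure.quasiMeasurePreserving_eval (fun _ : Fin k => μ) i).ae hdiag
  · cases k with
    | zero => exact i.elim0
    | succ k =>
      obtain ⟨j', rfl⟩ := Fin.exists_succAbove_eq (Ne.symm hij)
      have h1 := (measurePreserving_piFinSuccAbove (fun _ : Fin (k + 1) => μ) i)
      have h2 := QuasiMeasurePreserving.prodMap (Measure.QuasiMeasurePreserving.id μ)
        (Measure.quasiMeasurePreserving_eval (fun _ : Fin k => μ) j')
      exact (h2.comp h1.quasiMeasurePreserving).ae hoff

/-- The determinant of a Gram matrix of a family drawn from an orthonormal basis. -/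
lemma sum_sign_prod_ite {ι : Type*} [DecidableEq ι] {k : ℕ} (f : Fin k → ι) :
    ∑ σ : Equiv.Perm (Fin k), (Equiv.Perm.sign σ : ℂ) *
      ∏ j, (if f (σ.symm j) = f j then (1 : ℂ) else 0) =
      if Function.Injective f then 1 else 0 := by
  have h : ∑ σ : Equiv.Perm (Fin k), (Equiv.Perm.sign σ : ℂ) *
      ∏ j, (if f (σ.symm j) = f j then (1 : ℂ) else 0) =
      (Matrix.of fun i j => if f j = f i then (1 : ℂ) else 0).det := by
    rw [det_apply']
    refine Finset.sum_congr rfl fun σ _ => ?_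
    congr 1
    rw [← Equiv.prod_comp σ]
    simp
  rw [h]
  split_ifs with hf
  · have : (Matrix.of fun i j => if f j = f i then (1 : ℂ) else 0) = 1 := by
      ext i j
      simp [one_apply, hf.eq_iff, eq_comm]
    rw [this, det_one]
  · rw [Function.not_injective_iff] at hf
    obtain ⟨a, b, hab, hne⟩ := hf
    refine det_zero_of_row_eq hne ?_
    ext j
    simp [hab]

/-- The integrated determinants of a diagonalized kernel. -/
lemma IsOrthonormalFamily.integral_det {Λ : Type*} [MeasurableSpace Λ] {μ : Measure Λ}
    [SigmaFinite μ] {ι : Type*} [Fintype ι] [DecidableEq ι] {φ : ι → Λ → ℂ}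
    (hφ : IsOrthonormalFamily μ φ) (l : ι → ℂ) (k : ℕ) :
    ∫ x, (Matrix.of fun i j : Fin k => ∑ a, φ a (x i) * l a * conj (φ a (x j))).det
      ∂(Measure.pi fun _ : Fin k => μ) = ∑ f : Fin k ↪ ι, ∏ i, l (f i) := by
  -- Leibniz expansion, with an eigenfunction `f i` chosen in each entry. Reindexing by `σ` collects
  -- the two factors containing `x j`, so the integral factorizes over coordinates.
  have hpt : ∀ x : Fin k → Λ,
      (Matrix.of fun i j : Fin k => ∑ a, φ a (x i) * l a * conj (φ a (x j))).det =
      ∑ f : Fin k → ι, ∑ σ : Equiv.Perm (Fin k), (∏ i, l (f i)) * (Equiv.Perm.sign σ : ℂ) *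
        ∏ j, (φ (f (σ.symm j)) (x j) * conj (φ (f j) (x j))) := by
    intro x
    rw [det_apply', Finset.sum_comm]
    refine Finset.sum_congr rfl fun σ _ => ?_
    simp only [of_apply]
    rw [Finset.prod_univ_sum, Finset.mul_sum, Fintype.piFinset_univ]
    refine Finset.sum_congr rfl fun f _ => ?_
    rw [Finset.prod_mul_distrib, Finset.prod_mul_distrib, Finset.prod_mul_distrib,
      ← Equiv.prod_comp σ fun j => φ (f (σ.symm j)) (x j)]
    simp only [Equiv.symm_apply_apply]
    ring
  have hint : ∀ (f : Fin k → ι) (σ : Equiv.Perm (Fin k)), Integrable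
      (fun x : Fin k → Λ => (∏ i, l (f i)) * (Equiv.Perm.sign σ : ℂ) *
        ∏ j, (φ (f (σ.symm j)) (x j) * conj (φ (f j) (x j)))) (Measure.pi fun _ : Fin k => μ) :=
    fun f σ => (Integrable.fintype_prod
      (f := fun j x => φ (f (σ.symm j)) x * conj (φ (f j) x))
      fun j => hφ.integrable _ _).const_mul _
  simp_rw [hpt]
  rw [integral_finsetSum _ fun f _ => integrable_finsetSum _ fun σ _ => hint f σ]
  have hf : ∀ f : Fin k → ι, ∫ x : Fin k → Λ, ∑ σ : Equiv.Perm (Fin k),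
      (∏ i, l (f i)) * (Equiv.Perm.sign σ : ℂ) *
        ∏ j, (φ (f (σ.symm j)) (x j) * conj (φ (f j) (x j))) ∂(Measure.pi fun _ : Fin k => μ) =
      if Function.Injective f then ∏ i, l (f i) else 0 := by
    intro f
    rw [integral_finsetSum _ fun σ _ => hint f σ]
    have : ∀ σ : Equiv.Perm (Fin k), ∫ x : Fin k → Λ, (∏ i, l (f i)) * (Equiv.Perm.sign σ : ℂ) *
        ∏ j, (φ (f (σ.symm j)) (x j) * conj (φ (f j) (x j))) ∂(Measure.pi fun _ : Fin k => μ) =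
        (∏ i, l (f i)) * ((Equiv.Perm.sign σ : ℂ) *
          ∏ j, (if f (σ.symm j) = f j then (1 : ℂ) else 0)) := by
      intro σ
      rw [integral_const_mul, integral_fintype_prod_eq_prod
        (f := fun j x => φ (f (σ.symm j)) x * conj (φ (f j) x))]
      simp_rw [hφ.integral_eq]
      ring
    simp_rw [this]
    rw [← Finset.mul_sum, sum_sign_prod_ite]
    simp
  simp_rw [hf]
  rw [← Finset.sum_filter, Finset.sum_subtype (p := Function.Injective) _ (by simp)]
  exact Fintype.sum_equiv (Equiv.subtypeInjectiveEquivEmbedding (Fin k) ι) _ _ fun f => rfl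

/-- All entries of the determinant can be replaced at almost every tuple; the entries `K (x i) (x
i)` require the diagonal formula. -/
lemma IsFiniteRankKernel.integral_det {Λ : Type*} [MeasurableSpace Λ] {μ : Measure Λ}
    [SigmaFinite μ] {K : Λ → Λ → ℂ} {ι : Type*} [Fintype ι] [DecidableEq ι] {φ : ι → Λ → ℂ}
    {l : ι → ℂ} (h : IsFiniteRankKernel μ K φ (diagonal l)) (hφ : IsOrthonormalFamily μ φ)
    (k : ℕ) :
    ∫ x, (Matrix.of fun i j : Fin k => K (x i) (x j)).det ∂(Measure.pi fun _ : Fin k => μ) =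
      ∑ f : Fin k ↪ ι, ∏ i, l (f i) := by
  rw [← hφ.integral_det l k]
  refine integral_congr_ae ?_
  have hd : ∀ x z, ∑ a, ∑ b, φ a x * diagonal l a b * conj (φ b z) =
      ∑ a, φ a x * l a * conj (φ a z) := by
    intro x z
    refine Finset.sum_congr rfl fun a _ => ?_
    rw [Finset.sum_eq_single a]
    · simp
    · intro b _ hb
      simp [diagonal_apply_ne _ hb.symm]
    · simp
  have h1 := h.diag
  have h2 := h.offDiag
  simp_rw [hd] at h1 h2
  filter_upwards [ae_pi_forall_pair μ (p := fun x z => K x z = ∑ a, φ a x * l a * conj (φ a z))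
    h1 h2 k] with x hx
  simp_rw [hx]

end DeterminantIntegral

/-! ### Perturbation of ordered eigenvalues -/

section HoffmanWielandt

open Matrix

lemma sum_norm_sq_eq_trace {n : Type*} [Fintype n] (D : Matrix n n ℂ) :
    ((∑ i, ∑ j, ‖D i j‖ ^ 2 : ℝ) : ℂ) = (Dᴴ * D).trace := by
  rw [Finset.sum_comm]
  simp [Matrix.trace, Matrix.mul_apply, Complex.conj_mul']

/-- In the trace of `Dᴴ * D` one unitary cancels directly and the other by cyclicity. -/
lemma sum_norm_sq_unitary_mul_mul {n : Type*} [Fintype n] [DecidableEq n] (U V D : Matrix n n ℂ)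
    (hU : U * star U = 1) (hV : V * star V = 1) :
    ∑ i, ∑ j, ‖(star U * D * V) i j‖ ^ 2 = ∑ i, ∑ j, ‖D i j‖ ^ 2 := by
  rw [← Complex.ofReal_inj, sum_norm_sq_eq_trace, sum_norm_sq_eq_trace]
  rw [star_eq_conjTranspose] at hU hV ⊢
  rw [conjTranspose_mul, conjTranspose_mul, conjTranspose_conjTranspose,
    show Vᴴ * (Dᴴ * U) * (Uᴴ * D * V) = Vᴴ * (Dᴴ * (U * Uᴴ) * D * V) by
      simp only [Matrix.mul_assoc], hU, Matrix.mul_one, trace_mul_comm, Matrix.mul_assoc,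
    Matrix.mul_assoc, hV, Matrix.mul_one]

/-- Row and column sums are the diagonal entries of `W * star W` and `star W * W`. -/
lemma normSq_mem_doublyStochastic {n : Type*} [Fintype n] [DecidableEq n] (W : Matrix n n ℂ)
    (h1 : W * star W = 1) (h2 : star W * W = 1) :
    (Matrix.of fun i j => ‖W i j‖ ^ 2) ∈ doublyStochastic ℝ n := by
  rw [mem_doublyStochastic_iff_sum]
  refine ⟨fun i j => sq_nonneg _, fun i => ?_, fun j => ?_⟩
  · have := congrFun (congrFun h1 i) i
    rw [Matrix.mul_apply, one_apply_eq] at this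
    rw [← Complex.ofReal_inj]
    push_cast
    rw [← this]
    exact Finset.sum_congr rfl fun j _ => by
      rw [of_apply, star_apply, RCLike.star_def, Complex.mul_conj']; push_cast; rfl
  · have := congrFun (congrFun h2 j) j
    rw [Matrix.mul_apply, one_apply_eq] at this
    rw [← Complex.ofReal_inj]
    push_cast
    rw [← this]
    exact Finset.sum_congr rfl fun i _ => by
      rw [of_apply, star_apply, RCLike.star_def, Complex.conj_mul']; push_cast; rfl

/-- Both spectra are listed in decreasing order along the same enumeration of the index type. -/
lemma Matrix.IsHermitian.monovary_eigenvalues {n : Type*} [Fintype n] [DecidableEq n]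
    {A B : Matrix n n ℂ} (hA : A.IsHermitian) (hB : B.IsHermitian) :
    Monovary hA.eigenvalues hB.eigenvalues := by
  intro i j hij
  refine hA.eigenvalues₀_antitone ?_
  by_contra! h
  exact absurd (hB.eigenvalues₀_antitone h.le) (not_le.2 hij)

lemma Matrix.IsHermitian.mul_eigenvectorUnitary {n : Type*} [Fintype n] [DecidableEq n]
    {A : Matrix n n ℂ} (hA : A.IsHermitian) :
    A * hA.eigenvectorUnitary.1 =
      hA.eigenvectorUnitary.1 * diagonal fun i => (hA.eigenvalues i : ℂ) := by
  have h := hA.conjStarAlgAut_star_eigenvectorUnitary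
  rw [Unitary.conjStarAlgAut_star_apply] at h
  have h2 := congrArg (hA.eigenvectorUnitary.1 * ·) h
  rw [← Matrix.mul_assoc, ← Matrix.mul_assoc] at h2
  rw [show hA.eigenvectorUnitary.1 * star hA.eigenvectorUnitary.1 = 1 from
    Unitary.coe_mul_star_self _, Matrix.one_mul] at h2
  exact h2

/-- **Hoffman–Wielandt inequality** for Hermitian matrices. -/
theorem Matrix.IsHermitian.sum_sq_sub_eigenvalues_le {n : Type*} [Fintype n] [DecidableEq n]
    {A B : Matrix n n ℂ} (hA : A.IsHermitian) (hB : B.IsHermitian) :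
    ∑ i, (hA.eigenvalues i - hB.eigenvalues i) ^ 2 ≤ ∑ i, ∑ j, ‖(A - B) i j‖ ^ 2 := by
  set U := hA.eigenvectorUnitary.1 with hU
  set V := hB.eigenvectorUnitary.1 with hV
  set a := hA.eigenvalues
  set b := hB.eigenvalues
  have hU1 : star U * U = 1 := Unitary.coe_star_mul_self _
  have hU2 : U * star U = 1 := Unitary.coe_mul_star_self _
  have hV1 : star V * V = 1 := Unitary.coe_star_mul_self _
  have hV2 : V * star V = 1 := Unitary.coe_mul_star_self _
  have hAU : star U * A = diagonal (fun i => (a i : ℂ)) * star U := by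
    have h := congrArg star hA.mul_eigenvectorUnitary
    rw [star_mul, star_mul, star_eq_conjTranspose A, hA.eq, star_eq_conjTranspose (diagonal _),
      diagonal_conjTranspose] at h
    rw [hU, h]
    congr 2
    ext i
    simp [a]
  have hBV : B * V = V * diagonal (fun i => (b i : ℂ)) := hB.mul_eigenvectorUnitary
  -- Between the two eigenbases, `A - B` has entries `(aᵢ - bⱼ) Wᵢⱼ` with `W = star U * V`.
  have hent : ∀ i j, (star U * (A - B) * V) i j = ((a i - b j : ℝ) : ℂ) * (star U * V) i j := by
    intro i j
    rw [Matrix.mul_sub, Matrix.sub_mul, hAU, Matrix.mul_assoc (star U) B, hBV,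
      ← Matrix.mul_assoc (star U) V, Matrix.mul_assoc (diagonal _), Matrix.sub_apply,
      diagonal_mul, mul_diagonal]
    push_cast
    ring
  rw [← sum_norm_sq_unitary_mul_mul U V (A - B) hU2 hV2]
  simp_rw [hent, norm_mul, mul_pow, Complex.norm_real, Real.norm_eq_abs, sq_abs]
  -- Birkhoff: the weights `|Wᵢⱼ|²` are a convex combination of permutation matrices.
  obtain ⟨w, hw0, hw1, hw⟩ := exists_eq_sum_perm_of_mem_doublyStochastic
    (normSq_mem_doublyStochastic (star U * V)
      (by rw [star_mul, star_star, show star U * V * (star V * U) = star U * (V * star V) * U by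
            simp only [Matrix.mul_assoc], hV2, Matrix.mul_one, hU1])
      (by rw [star_mul, star_star, show star V * U * (star U * V) = star V * (U * star U) * V by
            simp only [Matrix.mul_assoc], hU2, Matrix.mul_one, hV1]))
  have hw' : ∀ i j, ‖(star U * V) i j‖ ^ 2 = ∑ σ, w σ * if σ i = j then 1 else 0 := by
    intro i j
    have := congrFun (congrFun hw i) j
    rw [of_apply] at this
    rw [← this, Matrix.sum_apply]
    refine Finset.sum_congr rfl fun σ _ => ?_
    rw [Matrix.smul_apply, smul_eq_mul, Equiv.Perm.permMatrix, PEquiv.toMatrix_apply]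
    simp [Equiv.toPEquiv_apply, eq_comm]
  have hswap : ∑ i, ∑ j, (a i - b j) ^ 2 * ‖(star U * V) i j‖ ^ 2 =
      ∑ σ, w σ * ∑ i, (a i - b (σ i)) ^ 2 := by
    simp_rw [hw', Finset.mul_sum]
    rw [Finset.sum_congr rfl fun i _ => Finset.sum_comm, Finset.sum_comm]
    refine Finset.sum_congr rfl fun σ _ => Finset.sum_congr rfl fun i _ => ?_
    rw [Finset.sum_eq_single (σ i)]
    · simp
      ring
    · intro j _ hj
      simp [hj.symm]
    · simp
  rw [hswap]
  -- Rearrangement: the sums of squares do not depend on `σ`, and similarly ordered sequences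
  -- maximize the cross term.
  have hσ : ∀ σ : Equiv.Perm n, ∑ i, (a i - b i) ^ 2 ≤ ∑ i, (a i - b (σ i)) ^ 2 := by
    intro σ
    have h1 := (hA.monovary_eigenvalues hB).sum_mul_comp_perm_le_sum_mul (σ := σ)
    have h2 : ∑ i, b (σ i) ^ 2 = ∑ i, b i ^ 2 := Equiv.sum_comp σ fun i => b i ^ 2
    simp_rw [sub_sq, Finset.sum_add_distrib, Finset.sum_sub_distrib, mul_assoc,
      ← Finset.mul_sum, h2]
    linarith
  calc ∑ i, (a i - b i) ^ 2 = ∑ σ, w σ * ∑ i, (a i - b i) ^ 2 := by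
        rw [← Finset.sum_mul, hw1, one_mul]
    _ ≤ _ := Finset.sum_le_sum fun σ _ => mul_le_mul_of_nonneg_left (hσ σ) (hw0 σ)

/-- For Hermitian matrices of rank at most `N` with nonnegative eigenvalues, the `ℓ¹` distance of
the ordered eigenvalues is controlled by the Frobenius distance. -/
lemma Matrix.IsHermitian.sum_abs_sub_eigenvalues_le {n : Type*} [Fintype n] [DecidableEq n]
    {A B : Matrix n n ℂ} (hA : A.IsHermitian) (hB : B.IsHermitian) {N : ℕ} (hAN : A.rank ≤ N)
    (hBN : B.rank ≤ N) (hA0 : ∀ i, 0 ≤ hA.eigenvalues i) (hB0 : ∀ i, 0 ≤ hB.eigenvalues i) :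
    ∑ i, |hA.eigenvalues i - hB.eigenvalues i| ≤
      √(N * ∑ i, ∑ j, ‖(A - B) i j‖ ^ 2) := by
  set a := hA.eigenvalues with ha
  set b := hB.eigenvalues with hb
  set S := Finset.univ.filter fun i => a i ≠ 0 with hS
  set T := Finset.univ.filter fun i => b i ≠ 0 with hT
  have hScard : S.card ≤ N := by
    rw [hA.rank_eq_card_non_zero_eigs, Fintype.card_subtype] at hAN
    exact hAN
  have hTcard : T.card ≤ N := by
    rw [hB.rank_eq_card_non_zero_eigs, Fintype.card_subtype] at hBN
    exact hBN
  -- Nonnegative, similarly ordered sequences have nested supports; this gives the constant `N`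
  -- rather than `2N`.
  have hST : (S ∪ T).card ≤ N := by
    by_cases h : S ⊆ T
    · rwa [Finset.union_eq_right.2 h]
    · obtain ⟨i, hiS, hiT⟩ := Finset.not_subset.1 h
      have hTS : T ⊆ S := by
        intro j hj
        simp only [hS, hT, Finset.mem_filter, Finset.mem_univ, true_and, not_not] at hiS hiT hj ⊢
        have hlt : b i < b j := by
          rw [hiT]
          exact lt_of_le_of_ne (hB0 j) (Ne.symm hj)
        have hle : a i ≤ a j := hA.monovary_eigenvalues hB hlt
        exact ((lt_of_le_of_ne (hA0 i) (Ne.symm hiS)).trans_le hle).ne'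
      rwa [Finset.union_eq_left.2 hTS]
  refine Real.le_sqrt_of_sq_le ?_
  have hsum : ∑ i, |a i - b i| = ∑ i ∈ S ∪ T, |a i - b i| := by
    symm
    refine Finset.sum_subset (Finset.subset_univ _) fun i _ hi => ?_
    simp only [hS, hT, Finset.mem_union, Finset.mem_filter, Finset.mem_univ, true_and, not_or,
      not_not] at hi
    simp [hi.1, hi.2]
  calc (∑ i, |a i - b i|) ^ 2 ≤ (S ∪ T).card * ∑ i ∈ S ∪ T, |a i - b i| ^ 2 := by
        rw [hsum]
        exact sq_sum_le_card_mul_sum_sq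
    _ ≤ N * ∑ i, (a i - b i) ^ 2 := by
        simp_rw [sq_abs]
        refine mul_le_mul (by exact_mod_cast hST) ?_ (Finset.sum_nonneg fun i _ => sq_nonneg _)
          (Nat.cast_nonneg _)
        exact Finset.sum_le_sum_of_subset_of_nonneg (Finset.subset_univ _)
          fun i _ _ => sq_nonneg _
    _ ≤ N * ∑ i, ∑ j, ‖(A - B) i j‖ ^ 2 := by
        refine mul_le_mul_of_nonneg_left ?_ (Nat.cast_nonneg _)
        exact hA.sum_sq_sub_eigenvalues_le hB

end HoffmanWielandt

/-! ### From factorial moments to the law -/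

section GeneratingFunction

/-- Each `k`-subset is the image of exactly `k!` embeddings of `Fin k`. -/
lemma sum_embedding_prod {ι : Type*} [Fintype ι] [DecidableEq ι] (l : ι → ℝ) (k : ℕ) :
    ∑ f : Fin k ↪ ι, ∏ i, l (f i) =
      k.factorial * ∑ s ∈ Finset.powersetCard k Finset.univ, ∏ i ∈ s, l i := by
  have hmaps : ∀ f ∈ (Finset.univ : Finset (Fin k ↪ ι)),
      Finset.univ.map f ∈ Finset.powersetCard k (Finset.univ : Finset ι) := by
    intro f _
    simp [Finset.mem_powersetCard]
  rw [← Finset.sum_fiberwise_of_maps_to hmaps, Finset.mul_sum]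
  refine Finset.sum_congr rfl fun s hs => ?_
  have hsc : s.card = k := (Finset.mem_powersetCard.1 hs).2
  have hconst : ∀ f ∈ (Finset.univ : Finset (Fin k ↪ ι)).filter fun f => Finset.univ.map f = s,
      ∏ i, l (f i) = ∏ i ∈ s, l i := by
    intro f hf
    rw [← (Finset.mem_filter.1 hf).2, Finset.prod_map]
  have hcard : ((Finset.univ : Finset (Fin k ↪ ι)).filter fun f => Finset.univ.map f = s).card =
      k.factorial := by
    have h1 : Fintype.card (Fin k ↪ s) = k.factorial := by
      rw [Fintype.card_embedding_eq]
      simp [hsc, Nat.descFactorial_self]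
    rw [← h1, ← Finset.card_univ]
    symm
    refine Finset.card_nbij (fun g => g.trans (Function.Embedding.subtype _)) ?_ ?_ ?_
    · intro g _
      simp only [Finset.coe_filter, Finset.mem_univ, true_and]
      refine Finset.eq_of_subset_of_card_le ?_ (by simp [hsc])
      intro x hx
      obtain ⟨i, _, rfl⟩ := Finset.mem_map.1 hx
      exact (g i).2
    · intro g _ g' _ h
      ext i
      exact congrArg (fun e : Fin k ↪ ι => e i) h
    · intro f hf
      have hf' : Finset.univ.map f = s := by simpa using hf
      refine ⟨⟨fun i => ⟨f i, hf' ▸ Finset.mem_map_of_mem f (Finset.mem_univ i)⟩, ?_⟩,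
        by simp, ?_⟩
      · intro i j hij
        exact f.injective (congrArg Subtype.val hij)
      · ext i
        rfl
  rw [Finset.sum_congr rfl hconst, Finset.sum_const, hcard, nsmul_eq_mul]

lemma integrable_comp_of_bounded {Ω : Type*} [MeasurableSpace Ω] {P : Measure Ω}
    [IsFiniteMeasure P] {X : Ω → ℕ} (hX : Measurable X) {N : ℕ} (hN : ∀ᵐ ω ∂P, X ω ≤ N)
    (g : ℕ → ℝ) : Integrable (fun ω => g (X ω)) P := by
  refine Integrable.of_bound (C := ∑ n ∈ Finset.range (N + 1), |g n|)
    ((measurable_from_nat (f := g)).comp hX).aestronglyMeasurable ?_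
  filter_upwards [hN] with ω hω
  exact Finset.single_le_sum (f := fun n => |g n|) (fun n _ => abs_nonneg _)
    (Finset.mem_range.2 (Nat.lt_succ_of_le hω))

/-- Factorial moments determine the generating function. -/
lemma integral_pow_eq_prod {Ω : Type*} [MeasurableSpace Ω] {P : Measure Ω}
    [IsFiniteMeasure P] {X : Ω → ℕ} (hX : Measurable X) {N : ℕ} (hN : ∀ᵐ ω ∂P, X ω ≤ N)
    {ι : Type*} [Fintype ι] (l : ι → ℝ)
    (hmom : ∀ k : ℕ, ∫ ω, ((X ω).descFactorial k : ℝ) ∂P = ∑ f : Fin k ↪ ι, ∏ i, l (f i))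
    (t : ℝ) : ∫ ω, (1 + t) ^ X ω ∂P = ∏ i, (1 + t * l i) := by
  classical
  -- A common cutoff for expanding `(1 + t)^X` and the product in powers of `t`; the extra terms are
  -- zero.
  set M := max N (Fintype.card ι)
  have hpt : ∀ᵐ ω ∂P, (1 + t) ^ X ω = ∑ k ∈ Finset.range (M + 1),
      t ^ k / k.factorial * ((X ω).descFactorial k : ℝ) := by
    filter_upwards [hN] with ω hω
    rw [add_comm, add_pow]
    have hsub : Finset.range (X ω + 1) ⊆ Finset.range (M + 1) := by
      refine Finset.range_subset_range.2 ?_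
      have := le_max_left N (Fintype.card ι)
      lia
    refine (Finset.sum_subset hsub ?_).trans (Finset.sum_congr rfl fun k _ => ?_)
    · intro k _ hk
      rw [Nat.choose_eq_zero_of_lt (by simpa using hk)]
      simp
    · rw [Nat.descFactorial_eq_factorial_mul_choose]
      push_cast
      field_simp
      simp
  rw [integral_congr_ae hpt, integral_finsetSum _ fun k _ =>
    (integrable_comp_of_bounded hX hN fun n => (n.descFactorial k : ℝ)).const_mul _]
  simp_rw [integral_const_mul, hmom, sum_embedding_prod]
  rw [Finset.prod_one_add, Finset.sum_powerset]
  have hsub : Finset.range ((Finset.univ : Finset ι).card + 1) ⊆ Finset.range (M + 1) := by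
    refine Finset.range_subset_range.2 ?_
    rw [Finset.card_univ]
    exact Nat.succ_le_succ (le_max_right _ _)
  symm
  refine (Finset.sum_subset hsub ?_).trans (Finset.sum_congr rfl fun k _ => ?_)
  · intro k _ hk
    rw [Finset.powersetCard_eq_empty.2 (by simpa using hk), Finset.sum_empty]
  · rw [← mul_assoc, div_mul_cancel₀ _ (by positivity), Finset.mul_sum]
    refine Finset.sum_congr rfl fun s hs => ?_
    rw [Finset.prod_mul_distrib, Finset.prod_const, (Finset.mem_powersetCard.1 hs).2]

/-- The parameters in the factorized generating function are probabilities. -/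
lemma mem_Icc_of_integral_pow_eq_prod {Ω : Type*} [MeasurableSpace Ω] {P : Measure Ω}
    [IsProbabilityMeasure P] {X : Ω → ℕ} (hX : Measurable X) {N : ℕ} (hN : ∀ᵐ ω ∂P, X ω ≤ N)
    {ι : Type*} [Fintype ι] (l : ι → ℝ)
    (h : ∀ t : ℝ, ∫ ω, (1 + t) ^ X ω ∂P = ∏ i, (1 + t * l i)) (i : ι) :
    l i ∈ Set.Icc (0 : ℝ) 1 := by
  have hpos : ∀ t : ℝ, -1 < t → 0 < ∫ ω, (1 + t) ^ X ω ∂P := by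
    intro t ht
    have hp : ∀ ω, 0 < (1 + t) ^ X ω := fun ω => pow_pos (by linarith) _
    rw [integral_pos_iff_support_of_nonneg (fun ω => (hp ω).le)
      (integrable_comp_of_bounded hX hN fun n => (1 + t) ^ n)]
    have : Function.support (fun ω => (1 + t) ^ X ω) = Set.univ := by
      ext ω
      simpa using (hp ω).ne'
    rw [this, measure_univ]
    exact one_pos
  by_contra hl
  rw [Set.mem_Icc, not_and_or, not_le, not_le] at hl
  have hne : l i ≠ 0 := by
    rcases hl with hl | hl
    · exact hl.ne
    · exact (one_pos.trans hl).ne'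
  -- A parameter outside `[0, 1]` puts the zero `t = -1 / lᵢ` of the product to the right of `-1`,
  -- where the expectation is positive.
  have ht : -1 < -(l i)⁻¹ := by
    rcases hl with hl | hl
    · have := inv_lt_zero.2 hl
      linarith
    · have := inv_lt_one_of_one_lt₀ hl
      linarith
  have h1 := hpos _ ht
  rw [h, Finset.prod_eq_zero (Finset.mem_univ i)] at h1
  · exact lt_irrefl _ h1
  · rw [neg_mul, inv_mul_cancel₀ hne]
    ring

/-- Boundedness makes the generating function a polynomial whose coefficients are the point masses,
so its values determine the law. -/
lemma integral_pow_eq_eval {Ω : Type*} [MeasurableSpace Ω] {P : Measure Ω} [IsFiniteMeasure P]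
    {X : Ω → ℕ} (hX : Measurable X) {N : ℕ} (hXN : ∀ᵐ ω ∂P, X ω ≤ N) (z : ℝ) :
    ∫ ω, z ^ X ω ∂P =
      (∑ n ∈ Finset.range (N + 1), Polynomial.monomial n (P.real (X ⁻¹' {n}))).eval z := by
  have hpt : ∀ᵐ ω ∂P, z ^ X ω = ∑ n ∈ Finset.range (N + 1),
      (X ⁻¹' {n}).indicator (fun _ => z ^ n) ω := by
    filter_upwards [hXN] with ω hω
    rw [Finset.sum_eq_single (X ω)]
    · simp
    · intro n _ hn
      simp [hn.symm]
    · intro hn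
      exact absurd (Finset.mem_range.2 (Nat.lt_succ_of_le hω)) hn
  rw [integral_congr_ae hpt, integral_finsetSum _ fun n _ =>
    (integrable_const _).indicator (hX (measurableSet_singleton n)), Polynomial.eval_finsetSum]
  refine Finset.sum_congr rfl fun n _ => ?_
  rw [integral_indicator (hX (measurableSet_singleton n)), setIntegral_const,
    Polynomial.eval_monomial, smul_eq_mul]

lemma measure_preimage_singleton_eq_zero {Ω : Type*} [MeasurableSpace Ω] {P : Measure Ω}
    {X : Ω → ℕ} {N : ℕ} (hX : ∀ᵐ ω ∂P, X ω ≤ N) {n : ℕ} (hn : N < n) : P (X ⁻¹' {n}) = 0 := by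
  refine measure_mono_null ?_ hX
  intro ω hω hle
  rw [Set.mem_preimage, Set.mem_singleton_iff] at hω
  have : X ω ≤ N := hle
  lia

/-- Bounded `ℕ`-valued random variables with the same generating function have the same law. -/
lemma map_eq_map_of_integral_pow_eq {Ω Ω' : Type*} [MeasurableSpace Ω] [MeasurableSpace Ω']
    {P : Measure Ω} [IsFiniteMeasure P] {P' : Measure Ω'} [IsFiniteMeasure P'] {X : Ω → ℕ}
    {Y : Ω' → ℕ} (hX : Measurable X) (hY : Measurable Y) {N : ℕ} (hXN : ∀ᵐ ω ∂P, X ω ≤ N)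
    (hYN : ∀ᵐ ω ∂P', Y ω ≤ N) (h : ∀ z : ℝ, ∫ ω, z ^ X ω ∂P = ∫ ω, z ^ Y ω ∂P') :
    P.map X = P'.map Y := by
  have hpoly := Polynomial.funext fun z => (integral_pow_eq_eval hX hXN z).symm.trans
    ((h z).trans (integral_pow_eq_eval hY hYN z))
  refine Measure.ext_of_singleton fun n => ?_
  rw [Measure.map_apply hX (measurableSet_singleton n),
    Measure.map_apply hY (measurableSet_singleton n)]
  rcases lt_or_ge N n with hn | hn
  · rw [measure_preimage_singleton_eq_zero hXN hn, measure_preimage_singleton_eq_zero hYN hn]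
  · have := congrArg (fun p => Polynomial.coeff p n) hpoly
    simp only [Polynomial.finsetSum_coeff, Polynomial.coeff_monomial, Finset.sum_ite_eq',
      Finset.mem_range, Nat.lt_succ_of_le hn, if_true] at this
    exact (measureReal_eq_measureReal_iff).1 this

end GeneratingFunction

/-! ### Bernoulli sums and couplings -/

section Coupling

open unitInterval

/-- The number of coordinates `i` with `U i ≤ l i`; under the uniform law on the cube, a sum of
independent Bernoulli variables with parameters `l i`. -/
noncomputable def bernoulliCount {ι : Type*} [Fintype ι] (l : ι → I) (U : ι → I) : ℕ :=
  ∑ i, if U i ≤ l i then 1 else 0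

lemma measurable_bernoulliCount {ι : Type*} [Fintype ι] (l : ι → I) :
    Measurable (bernoulliCount l) := by
  refine Finset.measurable_sum _ fun i _ => Measurable.ite ?_ measurable_const measurable_const
  exact measurableSet_le (measurable_pi_apply i) measurable_const

lemma bernoulliCount_le {ι : Type*} [Fintype ι] (l : ι → I) (U : ι → I) :
    bernoulliCount l U ≤ Fintype.card ι := by
  rw [bernoulliCount, Finset.sum_boole]
  exact Finset.card_le_univ _

lemma integral_pow_bernoulliCount {ι : Type*} [Fintype ι] (l : ι → I) (t : ℝ) :
    ∫ U, (1 + t) ^ bernoulliCount l U ∂(Measure.pi fun _ : ι => (volume : Measure I)) =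
      ∏ i, (1 + t * (l i : ℝ)) := by
  have hpt : ∀ U : ι → I, (1 + t) ^ bernoulliCount l U =
      ∏ i, (1 + (Set.Iic (l i)).indicator (fun _ => t) (U i)) := by
    intro U
    rw [bernoulliCount, ← Finset.prod_pow_eq_pow_sum]
    refine Finset.prod_congr rfl fun i _ => ?_
    by_cases h : U i ≤ l i <;> simp [h]
  simp_rw [hpt]
  rw [integral_fintype_prod_eq_prod
    (f := fun i u => 1 + (Set.Iic (l i)).indicator (fun _ => t) u)]
  refine Finset.prod_congr rfl fun i _ => ?_
  rw [integral_add (integrable_const _) ((integrable_const _).indicator measurableSet_Iic),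
    integral_indicator measurableSet_Iic, setIntegral_const, Measure.real, volume_Iic,
    ENNReal.toReal_ofReal (l i).2.1]
  simp [mul_comm]

/-- With shared uniforms, the `i`-th indicators differ only when `U i` falls between `l i` and `l'
i`, an event of probability `|l i - l' i|`. -/
lemma lintegral_abs_sub_bernoulliCount_le {ι : Type*} [Fintype ι] (l l' : ι → I) :
    ∫⁻ U, ENNReal.ofReal |(bernoulliCount l U : ℝ) - bernoulliCount l' U|
      ∂(Measure.pi fun _ : ι => (volume : Measure I)) ≤
      ENNReal.ofReal (∑ i, |(l i : ℝ) - l' i|) := by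
  have hpt : ∀ U : ι → I, ENNReal.ofReal |(bernoulliCount l U : ℝ) - bernoulliCount l' U| ≤
      ∑ i, (Function.eval i ⁻¹' Set.uIoc (l i) (l' i)).indicator 1 U := by
    intro U
    have h1 : |(bernoulliCount l U : ℝ) - bernoulliCount l' U| ≤
        ∑ i, |(if U i ≤ l i then (1 : ℝ) else 0) - if U i ≤ l' i then 1 else 0| := by
      simp only [bernoulliCount]
      push_cast
      rw [← Finset.sum_sub_distrib]
      exact Finset.abs_sum_le_sum_abs _ _
    refine (ENNReal.ofReal_le_ofReal h1).trans ?_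
    rw [ENNReal.ofReal_sum_of_nonneg fun i _ => abs_nonneg _]
    refine Finset.sum_le_sum fun i _ => ?_
    by_cases h : U i ≤ l i <;> by_cases h' : U i ≤ l' i
    · simp [h, h']
    · rw [Set.indicator_of_mem]
      · simp [h, h']
      · exact Set.mem_uIoc.2 (Or.inr ⟨not_le.1 h', h⟩)
    · rw [Set.indicator_of_mem]
      · simp [h, h']
      · exact Set.mem_uIoc.2 (Or.inl ⟨not_le.1 h, h'⟩)
    · simp [h, h']
  have hmeas : ∀ i, MeasurableSet (Function.eval i ⁻¹' Set.uIoc (l i) (l' i) : Set (ι → I)) :=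
    fun i => measurable_pi_apply i measurableSet_uIoc
  refine (lintegral_mono hpt).trans ?_
  rw [lintegral_finsetSum _ fun i _ => measurable_one.indicator (hmeas i),
    ENNReal.ofReal_sum_of_nonneg fun i _ => abs_nonneg _]
  refine Finset.sum_le_sum fun i _ => ?_
  rw [lintegral_indicator_one (hmeas i), (measurePreserving_eval
    (fun _ : ι => (volume : Measure I)) i).measure_preimage measurableSet_uIoc.nullMeasurableSet,
    volume_uIoc, edist_comm, edist_dist, Subtype.dist_eq, Real.dist_eq]

/-- Two integer random variables distributed as sums of independent Bernoulli variables are as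
close in Wasserstein distance as their parameters. -/
lemma wassersteinOne_le_sum_abs {Ω Ω' : Type*} [MeasurableSpace Ω] [MeasurableSpace Ω']
    {P : Measure Ω} {P' : Measure Ω'} {X : Ω → ℤ} {Y : Ω' → ℤ} {ι : Type*} [Fintype ι]
    (l l' : ι → I)
    (hX : P.map X = (Measure.pi fun _ : ι => (volume : Measure I)).map
      fun U => (bernoulliCount l U : ℤ))
    (hY : P'.map Y = (Measure.pi fun _ : ι => (volume : Measure I)).map
      fun U => (bernoulliCount l' U : ℤ)) :
    wassersteinOne P X P' Y ≤ ENNReal.ofReal (∑ i, |(l i : ℝ) - l' i|) := by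
  have hm : ∀ l : ι → I, Measurable fun U => (bernoulliCount l U : ℤ) := fun l =>
    (measurable_from_nat (f := fun n : ℕ => (n : ℤ))).comp (measurable_bernoulliCount l)
  have hmp := (hm l).prodMk (hm l')
  have hπ : IsCoupling P X P' Y ((Measure.pi fun _ : ι => (volume : Measure I)).map
      fun U => ((bernoulliCount l U : ℤ), (bernoulliCount l' U : ℤ))) := by
    refine ⟨Measure.isProbabilityMeasure_map hmp.aemeasurable, ?_, ?_⟩
    · rw [Measure.map_map measurable_fst hmp, hX]
      rfl
    · rw [Measure.map_map measurable_snd hmp, hY]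
      rfl
  refine (iInf₂_le _ hπ).trans ?_
  rw [lintegral_map (measurable_of_countable _) hmp]
  refine le_trans (le_of_eq ?_) (lintegral_abs_sub_bernoulliCount_le l l')
  simp

/-- The total variation distance is at most the Wasserstein distance. -/
lemma ofReal_tvDist_le_wassersteinOne {Ω Ω' : Type*} [MeasurableSpace Ω] [MeasurableSpace Ω']
    {P : Measure Ω} {P' : Measure Ω'} {X : Ω → ℤ} {Y : Ω' → ℤ} (hX : Measurable X)
    (hY : Measurable Y) : ENNReal.ofReal (tvDist P X P' Y) ≤ wassersteinOne P X P' Y := by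
  refine le_iInf₂ fun π hπ => ?_
  have := hπ.isProbabilityMeasure
  have hne : MeasurableSet {z : ℤ × ℤ | z.1 ≠ z.2} := MeasurableSet.of_discrete
  -- Distinct integers are at distance at least `1`.
  have hbound : π {z | z.1 ≠ z.2} ≤ ∫⁻ z, ENNReal.ofReal |(z.1 : ℝ) - (z.2 : ℝ)| ∂π := by
    rw [← lintegral_indicator_one hne]
    refine lintegral_mono fun z => ?_
    by_cases h : z.1 = z.2
    · simp [h]
    · rw [Set.indicator_of_mem (by exact h), Pi.one_apply, ← ENNReal.ofReal_one]
      refine ENNReal.ofReal_le_ofReal ?_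
      have : 1 ≤ |z.1 - z.2| := Int.one_le_abs (sub_ne_zero.2 h)
      exact_mod_cast this
  refine le_trans ?_ hbound
  rw [← ofReal_measureReal]
  refine ENNReal.ofReal_le_ofReal (ciSup_le fun A => ?_)
  have h1 : P.real (X ⁻¹' A) = π.real (Prod.fst ⁻¹' A) := by
    rw [Measure.real, Measure.real, ← Measure.map_apply hX MeasurableSet.of_discrete,
      ← Measure.map_apply measurable_fst MeasurableSet.of_discrete, hπ.map_fst]
  have h2 : P'.real (Y ⁻¹' A) = π.real (Prod.snd ⁻¹' A) := by
    rw [Measure.real, Measure.real, ← Measure.map_apply hY MeasurableSet.of_discrete,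
      ← Measure.map_apply measurable_snd MeasurableSet.of_discrete, hπ.map_snd]
  rw [h1, h2, abs_sub_le_iff]
  have key : ∀ S T : Set (ℤ × ℤ), S ⊆ T ∪ {z | z.1 ≠ z.2} →
      π.real S - π.real T ≤ π.real {z | z.1 ≠ z.2} := by
    intro S T hST
    have := (measureReal_mono (μ := π) hST).trans (measureReal_union_le _ _)
    linarith
  constructor
  · refine key _ _ fun z hz => ?_
    by_cases h : z.1 = z.2
    · left
      rw [Set.mem_preimage, ← h]
      exact hz
    · exact Or.inr h
  · refine key _ _ fun z hz => ?_
    by_cases h : z.1 = z.2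
    · left
      rw [Set.mem_preimage, h]
      exact hz
    · exact Or.inr h

end Coupling

/-! ### Law of the number of points -/

section Main

open unitInterval

variable {Ω Λ : Type*} [MeasurableSpace Ω] [TopologicalSpace Λ] [MeasurableSpace Λ]
  {P : Measure Ω} {χ : Ω → Measure Λ} {μ : Measure Λ} {K : Λ → Λ → ℂ}

lemma IsSimplePointProcess.measurable_totalCount (hχ : IsSimplePointProcess P χ) :
    Measurable (totalCount χ) :=
  Int.measurable_floor.comp
    ((Measure.measurable_coe MeasurableSet.univ).comp hχ.measurable).ennreal_toReal

/-- For a bounded point process the integer `totalCount` is the total mass. -/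
lemma IsSimplePointProcess.ae_totalCount (hχ : IsSimplePointProcess P χ) {N : ℕ}
    (hN : ∀ᵐ ω ∂P, χ ω Set.univ ≤ (N : ℝ≥0∞)) :
    ∀ᵐ ω ∂P, χ ω Set.univ = ((totalCount χ ω).toNat : ℝ≥0∞) ∧
      totalCount χ ω = ((totalCount χ ω).toNat : ℤ) ∧ (totalCount χ ω).toNat ≤ N := by
  filter_upwards [hχ.integerValued, hN] with ω h1 h2
  obtain ⟨n, hn⟩ := h1 _ MeasurableSet.univ
  rw [hn] at h2
  have htop : n ≠ ⊤ := by
    rintro rfl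
    simp at h2
  lift n to ℕ using htop
  rw [ENat.toENNReal_coe] at h2 hn
  have hcount : totalCount χ ω = n := by
    rw [totalCount, hn]
    simp
  rw [hcount, hn]
  exact ⟨rfl, rfl, by exact_mod_cast h2⟩

variable [PolishSpace Λ] [BorelSpace Λ]

/-- Factorial moments of a determinantal process as integrals of the joint intensities. -/
lemma IsDeterminantal.exists_lintegral_descFactorial_eq (hχ : IsDeterminantal P χ μ K) {N : ℕ}
    (hN : ∀ᵐ ω ∂P, χ ω Set.univ ≤ (N : ℝ≥0∞)) (k : ℕ) :
    ∃ ρ : (Fin k → Λ) → ℝ≥0, AEMeasurable ρ (Measure.pi fun _ => μ) ∧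
      (∀ᵐ x ∂(Measure.pi fun _ : Fin k => μ),
        ((ρ x : ℝ) : ℂ) = (Matrix.of fun i j => K (x i) (x j)).det) ∧
      ∫⁻ ω, ((totalCount χ ω).toNat.descFactorial k : ℝ≥0∞) ∂P =
        ∫⁻ x, (ρ x : ℝ≥0∞) ∂(Measure.pi fun _ : Fin k => μ) := by
  obtain ⟨ρ, hρ, hdet⟩ := hχ.jointIntensity k
  refine ⟨ρ, hρ.aemeasurable, hdet, lintegral_descFactorial_eq hχ.toIsSimplePointProcess hρ ?_ _
    ((hχ.ae_totalCount hN).mono fun ω h => h.1)⟩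
  -- Repeated points give equal rows, so the intensity vanishes there even where atoms of `μ` charge
  -- the diagonal.
  filter_upwards [hdet] with x hx hinj
  obtain ⟨a, b, hab, hne⟩ := Function.not_injective_iff.1 hinj
  rw [Matrix.det_zero_of_row_eq hne (by ext j; simp [hab])] at hx
  exact_mod_cast hx

/-- At most `N` points make the factorial moment of order `k > N` zero, and a nonnegative intensity
with zero integral vanishes almost everywhere. -/
lemma IsDeterminantal.ae_det_eq_zero (hχ : IsDeterminantal P χ μ K) {N : ℕ}
    (hN : ∀ᵐ ω ∂P, χ ω Set.univ ≤ (N : ℝ≥0∞)) (k : ℕ) (hk : N < k) :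
    ∀ᵐ x ∂(Measure.pi fun _ : Fin k => μ), (Matrix.of fun i j => K (x i) (x j)).det = 0 := by
  obtain ⟨ρ, hρm, hdet, hρ⟩ := hχ.exists_lintegral_descFactorial_eq hN k
  have h0 : ∫⁻ ω, ((totalCount χ ω).toNat.descFactorial k : ℝ≥0∞) ∂P = 0 := by
    refine lintegral_eq_zero_of_ae_eq_zero ?_
    filter_upwards [hχ.ae_totalCount hN] with ω h
    rw [Nat.descFactorial_eq_zero_iff_lt.2 (h.2.2.trans_lt hk)]
    simp
  rw [h0, eq_comm, lintegral_eq_zero_iff' hρm.coe_nnreal_ennreal] at hρ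
  filter_upwards [hρ, hdet] with x h1 h2
  have h3 : ρ x = 0 := by simpa using h1
  rw [← h2, h3]
  simp

lemma IsDeterminantal.integral_descFactorial (hχ : IsDeterminantal P χ μ K) {N : ℕ}
    (hN : ∀ᵐ ω ∂P, χ ω Set.univ ≤ (N : ℝ≥0∞)) (k : ℕ) :
    ((∫ ω, ((totalCount χ ω).toNat.descFactorial k : ℝ) ∂P : ℝ) : ℂ) =
      ∫ x, (Matrix.of fun i j => K (x i) (x j)).det ∂(Measure.pi fun _ : Fin k => μ) := by
  obtain ⟨ρ, hρm, hdet, hρ⟩ := hχ.exists_lintegral_descFactorial_eq hN k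
  rw [← integral_congr_ae hdet, integral_complex_ofReal,
    integral_eq_lintegral_of_nonneg_ae (f := fun x => (ρ x : ℝ))
      (Filter.Eventually.of_forall fun x => (ρ x).2)
      hρm.coe_nnreal_real.aestronglyMeasurable,
    integral_eq_lintegral_of_nonneg_ae (Filter.Eventually.of_forall fun ω => Nat.cast_nonneg _)
      ((measurable_from_top (f := fun n : ℤ => (n.toNat.descFactorial k : ℝ))).comp
        hχ.measurable_totalCount).aestronglyMeasurable]
  congr 2
  simp only [ENNReal.ofReal_natCast, ENNReal.ofReal_coe_nnreal]
  exact hρ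

/-- The number of points of a determinantal process with finite rank kernel is a sum of
independent Bernoulli variables whose parameters are the eigenvalues of the kernel. -/
lemma IsDeterminantal.exists_map_totalCount_eq [SigmaFinite μ] [IsProbabilityMeasure P]
    (hχ : IsDeterminantal P χ μ K) {N : ℕ} (hN : ∀ᵐ ω ∂P, χ ω Set.univ ≤ (N : ℝ≥0∞))
    {ι : Type*} [Fintype ι] [DecidableEq ι] {e : ι → Λ → ℂ} {A : Matrix ι ι ℂ}
    (hA : IsFiniteRankKernel μ K e A) (he : IsOrthonormalFamily μ e) :
    ∃ l : ι → I, (∀ i, (l i : ℝ) = hA.isHermitian.eigenvalues i) ∧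
      P.map (totalCount χ) = (Measure.pi fun _ : ι => (volume : Measure I)).map
        fun U => (bernoulliCount l U : ℤ) := by
  obtain ⟨φ, hφ, hK⟩ := hA.diagonalize he
  have hae := hχ.ae_totalCount hN
  have hXm : Measurable fun ω => (totalCount χ ω).toNat :=
    (measurable_from_top (f := fun n : ℤ => n.toNat)).comp hχ.measurable_totalCount
  have hXN : ∀ᵐ ω ∂P, (totalCount χ ω).toNat ≤ N := hae.mono fun ω h => h.2.2
  have hgen := integral_pow_eq_prod hXm hXN hA.isHermitian.eigenvalues fun k => by
    rw [← Complex.ofReal_inj, hχ.integral_descFactorial hN k, hK.integral_det hφ k]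
    push_cast
    rfl
  have hmem := mem_Icc_of_integral_pow_eq_prod hXm hXN _ hgen
  refine ⟨fun i => ⟨_, hmem i⟩, fun i => rfl, ?_⟩
  have hmap := map_eq_map_of_integral_pow_eq hXm
    (measurable_bernoulliCount fun i => (⟨_, hmem i⟩ : I)) (N := max N (Fintype.card ι))
    (P' := Measure.pi fun _ : ι => (volume : Measure I))
    (hXN.mono fun ω h => h.trans (le_max_left _ _))
    (Filter.Eventually.of_forall fun U => (bernoulliCount_le _ U).trans (le_max_right _ _))
    fun z => by
      have h1 := hgen (z - 1)
      have h2 := integral_pow_bernoulliCount (fun i => (⟨_, hmem i⟩ : I)) (z - 1)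
      rw [add_sub_cancel] at h1 h2
      exact h1.trans h2.symm
  have hcast : Measurable fun n : ℕ => (n : ℤ) := measurable_from_nat
  have := congrArg (Measure.map fun n : ℕ => (n : ℤ)) hmap
  rw [Measure.map_map hcast hXm, Measure.map_map hcast (measurable_bernoulliCount _)] at this
  exact (Measure.map_congr (hae.mono fun ω h => h.2.1)).trans this

end Main

/-! ### Comparison of the two processes -/

/-- Two kernels of finite rank can be written in a common orthonormal family. -/
lemma exists_common_isFiniteRankKernel {Λ : Type*} [MeasurableSpace Λ] {μ : Measure Λ}
    [SFinite μ] {K K' : Λ → Λ → ℂ} {r r' : ℕ} {u : Fin r → Λ → ℂ} {u' : Fin r' → Λ → ℂ}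
    {H : Matrix (Fin r) (Fin r) ℂ} {H' : Matrix (Fin r') (Fin r') ℂ}
    (h : IsFiniteRankKernel μ K u H) (h' : IsFiniteRankKernel μ K' u' H') :
    ∃ (m : ℕ) (e : Fin m → Λ → ℂ) (A A' : Matrix (Fin m) (Fin m) ℂ),
      IsOrthonormalFamily μ e ∧ IsFiniteRankKernel μ K e A ∧ IsFiniteRankKernel μ K' e A' ∧
      A.rank ≤ r ∧ A'.rank ≤ r' := by
  obtain ⟨m, e, he, C, hC⟩ := exists_isOrthonormalFamily μ (Sum.elim u u')
    (Sum.forall.2 ⟨h.memLp, h'.memLp⟩)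
  -- The common family may have more than `N` members, but each matrix factors through the smaller
  -- size `s`.
  have hrank : ∀ {s : ℕ} (B : Matrix (Fin m) (Fin s) ℂ) (G : Matrix (Fin s) (Fin s) ℂ)
      (D : Matrix (Fin s) (Fin m) ℂ), (B * G * D).rank ≤ s := fun B G D =>
    (Matrix.rank_mul_le_right _ _).trans ((Matrix.rank_le_card_height D).trans (by simp))
  exact ⟨m, e, _, _, he, h.change e he.memLp (Matrix.of fun i b => C (Sum.inl i) b)
    (fun i => hC (Sum.inl i)), h'.change e he.memLp (Matrix.of fun i b => C (Sum.inr i) b)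
    (fun i => hC (Sum.inr i)), hrank _ _ _, hrank _ _ _⟩

/-- The squared Hilbert–Schmidt distance of two kernels in a common orthonormal family. -/
lemma IsFiniteRankKernel.integral_norm_sub_sq {Λ : Type*} [MeasurableSpace Λ] {μ : Measure Λ}
    [SFinite μ] {K K' : Λ → Λ → ℂ} {ι : Type*} [Fintype ι] [DecidableEq ι] {e : ι → Λ → ℂ}
    {A A' : Matrix ι ι ℂ} (h : IsFiniteRankKernel μ K e A) (h' : IsFiniteRankKernel μ K' e A')
    (he : IsOrthonormalFamily μ e) (hL2 : MemLp (fun p : Λ × Λ => K p.1 p.2) 2 (μ.prod μ))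
    (hL2' : MemLp (fun p : Λ × Λ => K' p.1 p.2) 2 (μ.prod μ)) :
    ∫ x, ∫ y, ‖K x y - K' x y‖ ^ 2 ∂μ ∂μ = ∑ i, ∑ j, ‖(A - A') i j‖ ^ 2 := by
  have hsub := hL2.sub hL2'
  have hint := (memLp_two_iff_integrable_sq_norm hsub.1).1 hsub
  rw [← he.integral_norm_sq (A - A')]
  refine (integral_integral hint).trans (integral_congr_ae ?_)
  filter_upwards [h.offDiag, h'.offDiag] with p h1 h2
  rw [h1, h2, ← Finset.sum_sub_distrib]
  simp_rw [← Finset.sum_sub_distrib, Matrix.sub_apply, mul_sub, sub_mul]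

theorem mainTheorem2 {Λ : Type*} [TopologicalSpace Λ] [LocallyCompactSpace Λ] [PolishSpace Λ]
    [MeasurableSpace Λ] [BorelSpace Λ] (μ : Measure Λ) [SigmaFinite μ]
    {Ω Ω' : Type*} [MeasurableSpace Ω] [MeasurableSpace Ω']
    (P : Measure Ω) [IsProbabilityMeasure P] (P' : Measure Ω') [IsProbabilityMeasure P']
    (χ : Ω → Measure Λ) (χ' : Ω' → Measure Λ) (K K' : Λ → Λ → ℂ)
    (hχ : IsDeterminantal P χ μ K) (hχ' : IsDeterminantal P' χ' μ K')
    (hK : ∀ x y, K x y = starRingEnd ℂ (K y x))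
    (hK' : ∀ x y, K' x y = starRingEnd ℂ (K' y x))
    (hL2 : MemLp (fun p : Λ × Λ => K p.1 p.2) 2 (μ.prod μ))
    (hL2' : MemLp (fun p : Λ × Λ => K' p.1 p.2) 2 (μ.prod μ))
    (N : ℕ) (hN : ∀ᵐ ω ∂P, χ ω Set.univ ≤ (N : ℝ≥0∞))
    (hN' : ∀ᵐ ω ∂P', χ' ω Set.univ ≤ (N : ℝ≥0∞)) :
    ENNReal.ofReal (tvDist P (totalCount χ) P' (totalCount χ')) ≤
        wassersteinOne P (totalCount χ) P' (totalCount χ') ∧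
      wassersteinOne P (totalCount χ) P' (totalCount χ') ≤
        ENNReal.ofReal (Real.sqrt ((N : ℝ) * ∫ x, ∫ y, ‖K x y - K' x y‖ ^ 2 ∂μ ∂μ)) := by

  refine ⟨ofReal_tvDist_le_wassersteinOne hχ.measurable_totalCount hχ'.measurable_totalCount, ?_⟩
  obtain ⟨r, hr, u, H, hu⟩ := exists_isFiniteRankKernel μ K hK hL2 N (hχ.ae_det_eq_zero hN)
  obtain ⟨r', hr', u', H', hu'⟩ :=
    exists_isFiniteRankKernel μ K' hK' hL2' N (hχ'.ae_det_eq_zero hN')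
  obtain ⟨m, e, A, A', he, hA, hA', hrA, hrA'⟩ := exists_common_isFiniteRankKernel hu hu'
  obtain ⟨l, hl, hlaw⟩ := hχ.exists_map_totalCount_eq hN hA he
  obtain ⟨l', hl', hlaw'⟩ := hχ'.exists_map_totalCount_eq hN' hA' he
  refine (wassersteinOne_le_sum_abs l l' hlaw hlaw').trans (ENNReal.ofReal_le_ofReal ?_)
  rw [hA.integral_norm_sub_sq hA' he hL2 hL2']
  simp_rw [hl, hl']
  -- The eigenvalues are nonnegative because they are the Bernoulli parameters.
  exact hA.isHermitian.sum_abs_sub_eigenvalues_le hA'.isHermitian (hrA.trans hr)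
    (hrA'.trans hr') (fun i => hl i ▸ (l i).2.1) (fun i => hl' i ▸ (l' i).2.1)
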